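/- **Theorem.** Let $K$ be a field of characteristic $0$ and let $t,h,Q\in K$ with $t\neq 0$, $t$ not a root of unity, $Q\neq 0$ and $Q\neq t^{j}$ for all $j\in\mathbb Z$. The crystallized deformed Virasoro algebra is generated by $\tilde T_n$ ($n\in\mathbb Z$) with the relations $$[\tilde T_n,\tilde T_m]=-(1-t^{-1})\sum_{\ell=1}^{n-m}\tilde T_{n-\ell}\tilde T_{m+\ell}\qquad(n>m>0\ \text{or}\ 0>n>m),$$ $$[\tilde T_n,\tilde T_0]=-(1-t^{-1})\sum_{\ell=1}^{n}\tilde T_{n-\ell}\tilde T_{\ell}-(t-t^{-1})\sum_{\ell\ge1}t^{-\ell}\tilde T_{-\ell}\tilde T_{n+\ell}\qquad(n>0),$$ $$[\tilde T_0,\tilde T_m]=-(1-t^{-1})\sum_{\ell=1}^{-m}\tilde T_{-\ell}\tilde T_{m+\ell}-(t-t^{-1})\sum_{\ell\ge1}t^{-\ell}\tilde T_{m-\ell}\tilde T_{\ell}\qquad(0>m),$$ $$[\tilde T_n,\tilde T_m]=-(1-t^{-1})\tilde T_m\tilde T_n-(t-t^{-1})\sum_{\ell\ge1}t^{-\ell}\tilde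 T_{m-\ell}\tilde T_{n+\ell}+(1-t^{-1})\delta_{n+m,0}\qquad(n>0>m).$$ Let $M_h$ be its universal left highest weight module, generated by $|h\rangle$ with $\tilde T_0|h\rangle=h|h\rangle$ and $\tilde T_n|h\rangle=0$ for $n>0$ (every monomial in the $\tilde T_n$ of positive total degree kills $|h\rangle$, so the infinite sums act as finite sums), and let $M_h^*$ be the universal right module generated by $\langle h|$ with $\langle h|\tilde T_0=h\langle h|$ and $\langle h|\tilde T_n=0$ for $n<0$ (every monomial of negative total degree kills $\langle h|$). Then: 1. There is a unique bilinear pairing $M_h^*\times M_h\to K$ with $\langle h|h\rangle=1$ and $(\langle u|\tilde T_n)|v\rangle=\langle u|(\tilde T_n|v\rangle)$. 2. With $\tilde\Lambda$ a formal variable, there are a unique Whittaker vector $|\tilde G\rangle\in M_h[[\tilde\Lambda]]$ with $\tilde T_1|\tilde G\rangle=\tilde\Lambda^2|\tilde G\rangle$, $\tilde T_n|\tilde G\rangle=0$ $(n>1)$, $\langle h|\tilde G\rangle=1$, and a unique dual Whittaker vector $\langle\tilde G|\in M_h^*[[\tilde\Lambda]]$ with $\langle\tilde G|\tilde T_{-1}=\tilde\Lambda^2\langle\tilde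 G|$, $\langle\tilde G|\tilde T_n=0$ $(n<-1)$, $\langle\tilde G|h\rangle=1$. As formal power series in $\tilde\Lambda$, $$\langle\tilde G|\tilde G\rangle=\tilde Z^{\mathrm{inst}}_{\mathrm{pure}}(Q)=\sum_{m\ge0}\frac{\tilde\Lambda^{4m}}{\prod_{s=1}^m(1-t^{-s})},$$ where $$\tilde Z^{\mathrm{inst}}_{\mathrm{pure}}(Q)=\sum_{n,m\ge0}\frac{\tilde\Lambda^{4(n+m)}}{\prod_{s=1}^n(1-t^{-s})(1-Q^{-1}t^{n-m-s})\prod_{s=1}^m(1-t^{-s})(1-Q\,t^{m-n-s})}.$$ In particular $\langle\tilde G|\tilde G\rangle$ does not depend on $h$, and $\tilde Z^{\mathrm{inst}}_{\mathrm{pure}}(Q)$ does not depend on $Q$. 3. $\tilde Z^{\mathrm{inst}}_{\mathrm{pure}}(Q)$ is the $q\to0$ limit, with $\tilde\Lambda$ fixed and $\Lambda^4=\tilde\Lambda^4t/q$, of the 5D pure $SU(2)$ Nekrasov partition function $$Z^{\mathrm{inst}}_{\mathrm{pure}}=\sum_{\lambda,\mu}\frac{(\Lambda^4t/q)^{|\lambda|+|\mu|}}{N_{\lambda\lambda}(1)N_{\lambda\mu}(Q)N_{\mu\mu}(1)N_{\mu\lambda}(Q^{-1})},$$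 $$N_{\lambda\mu}(Q)=\prod_{(i,j)\in\lambda}\bigl(1-Qq^{\lambda_i-j}t^{\mu'_j-i+1}\bigr)\prod_{(i,j)\in\mu}\bigl(1-Qq^{-(\mu_i-j)-1}t^{-(\lambda'_j-i)}\bigr),$$ the sum being over pairs of partitions and $\lambda'$ denoting the conjugate partition: for each $N$ the coefficient of $\tilde\Lambda^{4N}$ is a rational function of the indeterminate $q$ over $K$ that is regular at $q=0$ and takes there the value of the coefficient of $\tilde\Lambda^{4N}$ in $\tilde Z^{\mathrm{inst}}_{\mathrm{pure}}(Q)$. -/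

import Mathlib

noncomputable section

namespace CrystalVirasoro

variable {K : Type*} [Field K]

/-! ### The crystallized deformed Virasoro algebra -/

/-- The free associative `K`-algebra on the symbols `T n`, `n ∈ ℤ`. -/
abbrev Free (K : Type*) [Field K] : Type _ := FreeAlgebra K ℤ

/-- The generator `T n`. -/
def T (n : ℤ) : Free K := FreeAlgebra.ι K n

/-- The monomial `T w₁ * T w₂ * ⋯` attached to a word `w = [w₁, w₂, …]`. -/
def word (w : List ℤ) : Free K := (w.map fun n => T n).prod

/-- The infinite sum `∑_{l ≥ 1} t^{-l} T_{m-l} T_{n+l}`, cut off after `l = N`. -/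
def tail (t : K) (n m : ℤ) (N : ℕ) : Free K :=
  ∑ l ∈ Finset.Icc 1 N, (t⁻¹ ^ l) • (T (m - (l : ℤ)) * T (n + (l : ℤ)))

/-- The right-hand side of the defining relation for `[T_n, T_m]`, `n > m`, of the crystallized
deformed Virasoro algebra, the infinite sum in it being cut off after `N` terms. -/
def bracket (t : K) (n m : ℤ) (N : ℕ) : Free K :=
  if 0 < m ∨ n < 0 then
    -((1 - t⁻¹) • ∑ l ∈ Finset.Icc 1 (n - m).toNat, T (n - (l : ℤ)) * T (m + (l : ℤ)))
  else if m = 0 then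
    -((1 - t⁻¹) • ∑ l ∈ Finset.Icc 1 n.toNat, T (n - (l : ℤ)) * T (l : ℤ))
      - (t - t⁻¹) • tail t n 0 N
  else if n = 0 then
    -((1 - t⁻¹) • ∑ l ∈ Finset.Icc 1 (-m).toNat, T (-(l : ℤ)) * T (m + (l : ℤ)))
      - (t - t⁻¹) • tail t 0 m N
  else
    -((1 - t⁻¹) • (T m * T n)) - (t - t⁻¹) • tail t n m N
      + (if n + m = 0 then algebraMap K (Free K) (1 - t⁻¹) else 0)

/-- The defining relation `[T_n, T_m] - bracket`, cut off after `N` terms of the infinite sum. -/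
def relator (t : K) (n m : ℤ) (N : ℕ) : Free K :=
  T n * T m - T m * T n - bracket t n m N

/-! ### Highest weight modules

`T n` lowers the energy by `n`. The module of highest weight `h` is the universal left module
generated by `|h⟩` with `T_0 |h⟩ = h |h⟩`, in which the words of total degree `> 0` annihilate
`|h⟩` (so `T_n |h⟩ = 0` for `n > 0`) and in which all defining relations hold. Applied to
`w |h⟩`, the terms of the infinite sum with `n + l + deg w > 0` vanish, so the sum may be cut off
at any `N` with `n + N + deg w ≥ 0`. -/

/-- The elements of the free algebra that annihilate `|h⟩`, up to left multiplication. -/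
def leftRelations (t h : K) : Set (Free K) :=
  {x | ∃ w : List ℤ, 0 < w.sum ∧ x = word w} ∪ {T 0 - algebraMap K (Free K) h} ∪
    {x | ∃ (n m : ℤ) (N : ℕ) (w : List ℤ), m < n ∧ 0 ≤ n + (N : ℤ) + w.sum ∧
      x = relator t n m N * word w}

/-- The highest weight module `M_h`: a left module over the free algebra, so that
`T n • v` is the action of the generator `T n`. -/
abbrev M (t h : K) : Type _ :=
  Free K ⧸ (Submodule.span (Free K) (leftRelations t h) : Submodule (Free K) (Free K))

/-- The highest weight vector `|h⟩`. -/
def ket (t h : K) : M t h := Submodule.Quotient.mk 1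

/-- The elements of the free algebra that annihilate `⟨h|`, up to right multiplication. -/
def rightRelations (t h : K) : Set (Free K) :=
  {x | ∃ w : List ℤ, w.sum < 0 ∧ x = word w} ∪ {T 0 - algebraMap K (Free K) h} ∪
    {x | ∃ (n m : ℤ) (N : ℕ) (w : List ℤ), m < n ∧ w.sum + m - (N : ℤ) ≤ 0 ∧
      x = word w * relator t n m N}

/-- The dual highest weight module `M_h^*`: a right module over the free algebra, written as a
left module over the opposite algebra, so that `MulOpposite.op (T n) • u` is `u T_n`. -/
abbrev Mdual (t h : K) : Type _ :=
  Free K ⧸ (Submodule.span (Free K)ᵐᵒᵖ (rightRelations t h) : Submodule (Free K)ᵐᵒᵖ (Free K))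

/-- The dual highest weight vector `⟨h|`. -/
def bra (t h : K) : Mdual t h := Submodule.Quotient.mk 1

/-- The bilinear pairing `⟨u|v⟩` of `M_h^*` and `M_h`: `⟨h|h⟩ = 1` and
`(⟨u|T_n)|v⟩ = ⟨u|(T_n|v⟩)`. -/
def IsPairing (t h : K) (B : Mdual t h →ₗ[K] M t h →ₗ[K] K) : Prop :=
  B (bra t h) (ket t h) = 1 ∧
    ∀ (n : ℤ) (u : Mdual t h) (v : M t h), B (MulOpposite.op (T n : Free K) • u) v = B u ((T n : Free K) • v)

/-! ### Whittaker vectors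

A formal power series in `Λ̃` with coefficients in a module is the sequence of its coefficients:
`G j` is the coefficient of `Λ̃ ^ j`. -/

/-- Multiplication of a formal power series in `Λ̃` by `Λ̃²`. -/
def mulLambdaSq {V : Type*} [Zero V] (G : ℕ → V) : ℕ → V
  | 0 => 0
  | 1 => 0
  | j + 2 => G j

/-- `|G̃⟩ ∈ M_h[[Λ̃]]` is the Whittaker vector: `T_1|G̃⟩ = Λ̃²|G̃⟩`, `T_n|G̃⟩ = 0` for `n > 1`,
normalized by `⟨h|G̃⟩ = 1`. -/
def IsWhittaker (t h : K) (B : Mdual t h →ₗ[K] M t h →ₗ[K] K) (G : ℕ → M t h) : Prop :=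
  (∀ j, (T 1 : Free K) • G j = mulLambdaSq G j) ∧ (∀ n : ℤ, 1 < n → ∀ j, (T n : Free K) • G j = 0) ∧
    ∀ j, B (bra t h) (G j) = if j = 0 then 1 else 0

/-- `⟨G̃| ∈ M_h^*[[Λ̃]]` is the dual Whittaker vector: `⟨G̃|T_{-1} = Λ̃²⟨G̃|`, `⟨G̃|T_n = 0` for
`n < -1`, normalized by `⟨G̃|h⟩ = 1`. -/
def IsDualWhittaker (t h : K) (B : Mdual t h →ₗ[K] M t h →ₗ[K] K) (G : ℕ → Mdual t h) : Prop :=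
  (∀ j, MulOpposite.op (T (-1) : Free K) • G j = mulLambdaSq G j) ∧
    (∀ n : ℤ, n < -1 → ∀ j, MulOpposite.op (T n : Free K) • G j = 0) ∧
    ∀ j, B (G j) (ket t h) = if j = 0 then 1 else 0

/-- The inner product of two formal power series in `Λ̃`, a formal power series in `Λ̃`. -/
def innerProduct {t h : K} (B : Mdual t h →ₗ[K] M t h →ₗ[K] K) (G' : ℕ → Mdual t h) (G : ℕ → M t h) :
    PowerSeries K :=
  PowerSeries.mk fun N => ∑ p ∈ Finset.HasAntidiagonal.antidiagonal N, B (G' p.1) (G p.2)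

/-! ### The Nekrasov partition function -/

theorem finite_youngDiagrams (n : ℕ) : {Y : YoungDiagram | Y.card = n}.Finite := by
  have key : ∀ (Y : YoungDiagram) (i j : ℕ), (i, j) ∈ Y → i < Y.card ∧ j < Y.card := by
    intro Y i j hij
    constructor
    · have h1 : i < Y.colLen j := YoungDiagram.mem_iff_lt_colLen.mp hij
      rw [YoungDiagram.colLen_eq_card] at h1
      exact lt_of_lt_of_le h1 (Finset.card_le_card (Finset.filter_subset _ _))
    · have h1 : j < Y.rowLen i := YoungDiagram.mem_iff_lt_rowLen.mp hij
      rw [YoungDiagram.rowLen_eq_card] at h1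
      exact lt_of_lt_of_le h1 (Finset.card_le_card (Finset.filter_subset _ _))
  refine Set.Finite.of_finite_image (f := YoungDiagram.cells) ?_ ?_
  · refine Set.Finite.subset
      (Finset.finite_toSet ((Finset.range n ×ˢ Finset.range n).powerset)) ?_
    rintro _ ⟨Y, hY, rfl⟩
    simp only [Finset.coe_powerset, Set.mem_preimage, Set.mem_powerset_iff, Finset.coe_subset]
    rintro ⟨i, j⟩ hc
    have := key Y i j ((YoungDiagram.mem_cells _).mp hc)
    have hn : Y.card = n := hY
    simp only [Finset.mem_product, Finset.mem_range]
    omega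
  · intro Y _ Z _ hYZ
    exact YoungDiagram.ext hYZ

/-- The Young diagrams with `n` boxes. -/
def youngDiagrams (n : ℕ) : Finset YoungDiagram := (finite_youngDiagrams n).toFinset

/-- The arm length `A_Y(i,j) = Y_i - j`; the box `c = (i - 1, j - 1)` is counted from zero. -/
def arm (Y : YoungDiagram) (c : ℕ × ℕ) : ℤ := (Y.rowLen c.1 : ℤ) - ((c.2 : ℤ) + 1)

/-- The leg length `L_Y(i,j) = Y'_j - i`; the box `c = (i - 1, j - 1)` is counted from zero. -/
def leg (Y : YoungDiagram) (c : ℕ × ℕ) : ℤ := (Y.colLen c.2 : ℤ) - ((c.1 : ℤ) + 1)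

/-- The Nekrasov factor `N_{Y W}(Q)`. -/
def nekrasovFactor {F : Type*} [Field F] (q t : F) (Y W : YoungDiagram) (Q : F) : F :=
  (∏ c ∈ Y.cells, (1 - Q * q ^ arm Y c * t ^ (leg W c + 1))) *
    ∏ c ∈ W.cells, (1 - Q * q ^ (-arm W c - 1) * t ^ (-leg Y c))

/-- The instanton partition function of the 5D pure `SU(2)` theory, as a formal power series in
the variable `Λ⁴`. -/
def nekrasovPure {F : Type*} [Field F] (q t Q : F) : PowerSeries F :=
  PowerSeries.mk fun N => ∑ p ∈ Finset.HasAntidiagonal.antidiagonal N,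
    ∑ Y ∈ youngDiagrams p.1, ∑ W ∈ youngDiagrams p.2,
      (t / q) ^ (Y.card + W.card) /
        (nekrasovFactor q t Y Y 1 * nekrasovFactor q t Y W Q *
          nekrasovFactor q t W W 1 * nekrasovFactor q t W Y Q⁻¹)

/-- The crystallized partition function `Z̃(Q)`, as a formal power series in the variable `Λ̃⁴`. -/
def crystalPure (t Q : K) : PowerSeries K :=
  PowerSeries.mk fun N => ∑ p ∈ Finset.HasAntidiagonal.antidiagonal N,
    ((∏ s ∈ Finset.Icc 1 p.1,
        (1 - t ^ (-(s : ℤ))) * (1 - Q⁻¹ * t ^ ((p.1 : ℤ) - (p.2 : ℤ) - (s : ℤ)))) *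
      ∏ s ∈ Finset.Icc 1 p.2,
        (1 - t ^ (-(s : ℤ))) * (1 - Q * t ^ ((p.2 : ℤ) - (p.1 : ℤ) - (s : ℤ))))⁻¹

/-- The rational function `f` of `q = RatFunc.X` is regular at `q = 0` with value `c` there, i.e.
`lim_{q → 0} f = c`. -/
def TendsToAtZero (f : RatFunc K) (c : K) : Prop :=
  ∃ a b : Polynomial K, b.eval 0 ≠ 0 ∧
    f = algebraMap (Polynomial K) (RatFunc K) a / algebraMap (Polynomial K) (RatFunc K) b ∧
    c = a.eval 0 / b.eval 0

end CrystalVirasoro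

end

/-! The norm is an oscillator computation. On the vectors built from the highest weight vector `v₀`
by `T_{-1}, …, T_{-n}`, every `T_p` with `p > n` vanishes, so the infinite relation between `T_n`
and `T_{-n}` collapses to `T_n T_{-n} = t⁻¹ T_{-n} T_n + (1 - t⁻¹)` (`IsHighestWeight.oscillator`).
For `n = 1` this gives `T_1 T_{-1}^{r+1} v₀ = (1 - t^{-(r+1)}) T_{-1}^r v₀`. Hence `∑ Λ̃^{2r}
T_{-1}^r v₀ / ∏_{s ≤ r} (1 - t^{-s})` is a Whittaker vector, and its norm is the stated series in
`Λ̃⁴`.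

Uniqueness: by induction, the difference of corresponding coefficients of two Whittaker vectors is
killed by all `T_n`, `n > 0`. The possible eigenvalues of `T_{-n} T_n` on the span above are `1 -
t^{-s}`; as `t` is not a root of unity, a vector killed by `T_n` cannot involve `T_{-n}`. Descending
in `n` leaves only multiples of `v₀` (`IsHighestWeight.mem_span_of_forall_apply_eq_zero`). The
antiautomorphism `T_n ↦ T_{-n}` makes `M_h^*` a highest weight representation, so the same lemmas
treat the dual vector.

The pairing is unique by normal ordering. Its existence requires that the relations do not collapse
the modules, and this is shown by bosonization: on a Fock space, `T_n` is `k V₊` for `n < 0`, `k⁻¹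
V₋` for `n > 0`, and the sum of both for `n = 0`, with `k + k⁻¹ = h` in an algebraic closure. The
relations become the operator products of `V₊` and `V₋`, whose contractions are `(1 - x) / (1 - t⁻¹
x)` and its inverse; the central term appears because `V₊` and `V₋` cancel at coinciding points. The
vacuum coefficient is then a functional vanishing on both the left and the right relations
(`exists_vacuumExpectation`).

On the combinatorial side, the coefficients `S_N` of the crystallized partition function satisfy `(1
- t^{-(N+1)}) S_{N+1} = S_N` (`sum_crystalTerm`), so `Q` drops out. In the limit `q → 0` every box
of positive arm length contributes a positive power of `q`; only pairs of single columns survive,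
and they give the crystallized terms. -/

noncomputable section

namespace CrystalVirasoro

section

variable {K : Type*} [Field K]

/-! ### The crystallized partition function does not depend on `Q` -/

/-- The product `∏_{s=1}^n (1 - x^s) (1 - a x^{s + d})`. -/
def crystalFactor (x a : K) (n : ℕ) (d : ℤ) : K :=
  ∏ s ∈ Finset.Icc 1 n, (1 - x ^ s) * (1 - a * x ^ ((s : ℤ) + d))

/-- Shifting the parameter `d` by one in `crystalFactor` telescopes. -/
theorem crystalFactor_shift (x a : K) (n : ℕ) (d : ℤ) :
    crystalFactor x a n (d + 1) * (1 - a * x ^ (d + 1)) =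
      crystalFactor x a n d * (1 - a * x ^ ((n : ℤ) + d + 1)) := by
  unfold crystalFactor
  induction n with
  | zero => simp
  | succ n ih =>
    rw [Finset.prod_Icc_succ_top (by omega), Finset.prod_Icc_succ_top (by omega)]
    have e : ((n + 1 : ℕ) : ℤ) + d = (n : ℤ) + d + 1 := by push_cast; ring
    have e' : ((n + 1 : ℕ) : ℤ) + (d + 1) = ((n + 1 : ℕ) : ℤ) + d + 1 := by ring
    rw [e', e]
    linear_combination ((1 - x ^ (n + 1)) * (1 - a * x ^ ((n : ℤ) + d + 1 + 1))) * ih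

/-- The factors `1 - x^s` lose their last member and the factors `1 - a x^{s+d}` their first; the
latter is what shifts `d`. -/
theorem crystalFactor_succ (x a : K) (n : ℕ) (d : ℤ) :
    crystalFactor x a (n + 1) d =
      crystalFactor x a n (d + 1) * (1 - x ^ (n + 1)) * (1 - a * x ^ (d + 1)) := by
  have h := crystalFactor_shift x a n d
  have e : ((n + 1 : ℕ) : ℤ) + d = (n : ℤ) + d + 1 := by push_cast; ring
  rw [mul_right_comm, h]
  unfold crystalFactor
  rw [Finset.prod_Icc_succ_top (by omega), e]
  ring

theorem crystalFactor_ne_zero {x a : K} (hx : ∀ n : ℕ, 0 < n → x ^ n ≠ 1)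
    (ha : ∀ j : ℤ, a * x ^ j ≠ 1) (n : ℕ) (d : ℤ) : crystalFactor x a n d ≠ 0 := by
  refine Finset.prod_ne_zero_iff.mpr fun s hs => mul_ne_zero ?_ ?_
  · exact sub_ne_zero.mpr (hx s (by simp at hs; omega)).symm
  · exact sub_ne_zero.mpr (ha _).symm

/-- The coefficients of the crystallized partition function. -/
def crystalTerm (x a b : K) (n m : ℕ) : K :=
  (crystalFactor x a n ((m : ℤ) - n) * crystalFactor x b m ((n : ℤ) - m))⁻¹

theorem crystalTerm_comm (x a b : K) (n m : ℕ) : crystalTerm x a b n m = crystalTerm x b a m n := by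
  unfold crystalTerm
  rw [mul_comm]

/-- This compares a term of level `N + 1` with one of level `N`. The multiplier on the left is the
first summand of `crystalTerm_add` at `(n, m + 1)`. -/
theorem crystalTerm_succ_right {x a b : K} (hx : ∀ n : ℕ, 0 < n → x ^ n ≠ 1)
    (ha : ∀ j : ℤ, a * x ^ j ≠ 1) (hb : ∀ j : ℤ, b * x ^ j ≠ 1) (n m : ℕ) :
    crystalTerm x a b n (m + 1) * ((1 - x ^ (m + 1)) * (1 - a * x ^ (m + 1))) /
        (1 - a * x ^ (((m + 1 : ℕ) : ℤ) - n)) =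
      crystalTerm x a b n m / (1 - b * x ^ ((n : ℤ) - m)) := by
  have h1 := crystalFactor_shift x a n ((m : ℤ) - n)
  have h2 := crystalFactor_succ x b m ((n : ℤ) - m - 1)
  have e1 : ((m + 1 : ℕ) : ℤ) - n = (m : ℤ) - n + 1 := by push_cast; ring
  have e2 : (n : ℤ) - ((m + 1 : ℕ) : ℤ) = (n : ℤ) - m - 1 := by push_cast; ring
  have e3 : (n : ℤ) + ((m : ℤ) - n) + 1 = ((m + 1 : ℕ) : ℤ) := by push_cast; ring
  rw [e3, zpow_natCast] at h1
  rw [sub_add_cancel] at h2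
  unfold crystalTerm
  rw [e1, e2, h2]
  have n1 := crystalFactor_ne_zero hx ha n ((m : ℤ) - n)
  have n2 := crystalFactor_ne_zero hx ha n ((m : ℤ) - n + 1)
  have n3 := crystalFactor_ne_zero hx hb m ((n : ℤ) - m)
  have n4 : 1 - x ^ (m + 1) ≠ 0 := sub_ne_zero.mpr (hx _ (by omega)).symm
  have n5 : 1 - b * x ^ ((n : ℤ) - m) ≠ 0 := sub_ne_zero.mpr (hb _).symm
  have n6 : 1 - a * x ^ ((m : ℤ) - n + 1) ≠ 0 := sub_ne_zero.mpr (ha _).symm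
  generalize crystalFactor x a n ((m : ℤ) - n) = A at *
  generalize crystalFactor x a n ((m : ℤ) - n + 1) = A' at *
  generalize crystalFactor x b m ((n : ℤ) - m) = B at *
  generalize 1 - x ^ (m + 1) = y at *
  generalize 1 - b * x ^ ((n : ℤ) - m) = z at *
  generalize 1 - a * x ^ ((m : ℤ) - n + 1) = w at *
  rw [div_eq_div_iff n6 n5]
  field_simp
  linear_combination -h1

/-- The partition of `1 - x^(n+m)` that splits each term of level `n + m` into a part coming from
`(n, m - 1)` and a part coming from `(n - 1, m)`. -/
theorem crystalTerm_add {x a b : K} (hx0 : x ≠ 0) (hab : a * b = 1)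
    (ha : ∀ j : ℤ, a * x ^ j ≠ 1) (hb : ∀ j : ℤ, b * x ^ j ≠ 1) (n m : ℕ) :
    (1 - x ^ (n + m)) =
      ((1 - x ^ m) * (1 - a * x ^ m)) / (1 - a * x ^ ((m : ℤ) - n)) +
        ((1 - x ^ n) * (1 - b * x ^ n)) / (1 - b * x ^ ((n : ℤ) - m)) := by
  have n5 : 1 - b * x ^ ((n : ℤ) - m) ≠ 0 := sub_ne_zero.mpr (hb _).symm
  have n6 : 1 - a * x ^ ((m : ℤ) - n) ≠ 0 := sub_ne_zero.mpr (ha _).symm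
  rw [div_add_div _ _ n6 n5, eq_div_iff (mul_ne_zero n6 n5)]
  have hb' : b = a⁻¹ := (eq_inv_of_mul_eq_one_right hab)
  have ha0 : a ≠ 0 := left_ne_zero_of_mul_eq_one hab
  subst hb'
  rw [zpow_sub₀ hx0, zpow_sub₀ hx0]
  simp only [zpow_natCast]
  rw [pow_add]
  have := pow_ne_zero n hx0
  have := pow_ne_zero m hx0
  generalize x ^ n = X at *
  generalize x ^ m = Y at *
  field_simp
  ring

/-- Multiplying level `N + 1` by `1 - x^(N+1)` and splitting every term by `crystalTerm_add`, each
term of level `N` is reached twice, with weights `1 / (1 - z)` and `1 / (1 - z⁻¹)`. These add up to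
one. -/
theorem sum_crystalTerm {x a b : K} (hx0 : x ≠ 0) (hab : a * b = 1)
    (hx : ∀ n : ℕ, 0 < n → x ^ n ≠ 1)
    (ha : ∀ j : ℤ, a * x ^ j ≠ 1) (hb : ∀ j : ℤ, b * x ^ j ≠ 1) (N : ℕ) :
    ∑ p ∈ Finset.HasAntidiagonal.antidiagonal N, crystalTerm x a b p.1 p.2 =
      (∏ s ∈ Finset.Icc 1 N, (1 - x ^ s))⁻¹ := by
  induction N with
  | zero => simp [crystalTerm, crystalFactor]
  | succ N ih =>
    have hN : 1 - x ^ (N + 1) ≠ 0 := sub_ne_zero.mpr (hx _ (by omega)).symm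
    rw [Finset.prod_Icc_succ_top (by omega), mul_inv, ← ih, eq_mul_inv_iff_mul_eq₀ hN,
      Finset.sum_mul]
    have h1 : ∀ p ∈ Finset.HasAntidiagonal.antidiagonal (N + 1),
        crystalTerm x a b p.1 p.2 * (1 - x ^ (N + 1)) =
        crystalTerm x a b p.1 p.2 * ((1 - x ^ p.2) * (1 - a * x ^ p.2)) /
          (1 - a * x ^ ((p.2 : ℤ) - p.1)) +
        crystalTerm x b a p.2 p.1 * ((1 - x ^ p.1) * (1 - b * x ^ p.1)) /
          (1 - b * x ^ ((p.1 : ℤ) - p.2)) := by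
      rintro ⟨n, m⟩ hp
      rw [Finset.HasAntidiagonal.mem_antidiagonal] at hp
      simp only at hp ⊢
      rw [← hp, crystalTerm_add hx0 hab ha hb n m, crystalTerm_comm x b a m n]
      ring
    rw [Finset.sum_congr rfl h1, Finset.sum_add_distrib, Finset.Nat.sum_antidiagonal_succ',
      Finset.Nat.sum_antidiagonal_succ]
    simp only [crystalTerm_succ_right hx ha hb, crystalTerm_succ_right hx hb ha]
    simp only [pow_zero, sub_self, zero_mul, mul_zero, zero_div, zero_add,
      ← Finset.sum_add_distrib]
    refine Finset.sum_congr rfl ?_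
    rintro ⟨n, m⟩ -
    rw [crystalTerm_comm x b a]
    have n5 : 1 - b * x ^ ((n : ℤ) - m) ≠ 0 := sub_ne_zero.mpr (hb _).symm
    have n6 : 1 - a * x ^ ((m : ℤ) - n) ≠ 0 := sub_ne_zero.mpr (ha _).symm
    -- The two denominators are `1 - w` and `1 - z` with `w z = 1`, whence `1 / (1 - w) + 1 / (1 -
    -- z) = 1`.
    have e : a * x ^ ((m : ℤ) - n) * (b * x ^ ((n : ℤ) - m)) = 1 := by
      rw [mul_mul_mul_comm, hab, ← zpow_add₀ hx0]; simp
    simp only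
    generalize b * x ^ ((n : ℤ) - m) = z at *
    generalize a * x ^ ((m : ℤ) - n) = w at *
    field_simp
    linear_combination -(crystalTerm x a b n m * e)

/-- The coefficient of `Λ̃^{4N}` in the crystallized partition function is a sum of
`crystalTerm`s. -/
theorem coeff_crystalPure (t Q : K) (N : ℕ) :
    PowerSeries.coeff N (crystalPure t Q) =
      ∑ p ∈ Finset.HasAntidiagonal.antidiagonal N, crystalTerm t⁻¹ Q⁻¹ Q p.1 p.2 := by
  rw [crystalPure, PowerSeries.coeff_mk]
  refine Finset.sum_congr rfl fun p _ => ?_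
  simp only [crystalTerm, crystalFactor, inv_zpow', zpow_neg, zpow_natCast, inv_pow]
  congr 2
  · refine Finset.prod_congr rfl fun s _ => ?_
    rw [← zpow_neg]; congr 4; ring
  · refine Finset.prod_congr rfl fun s _ => ?_
    rw [← zpow_neg]; congr 4; ring

theorem mul_inv_zpow_ne_one {t Q : K} (ht0 : t ≠ 0) (hQ : ∀ j : ℤ, Q ≠ t ^ j) (j : ℤ) :
    Q * t⁻¹ ^ j ≠ 1 := by
  intro h
  apply hQ j
  rw [inv_zpow] at h
  exact (mul_inv_eq_one₀ (zpow_ne_zero _ ht0)).mp h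

theorem inv_mul_inv_zpow_ne_one {t Q : K} (hQ0 : Q ≠ 0) (hQ : ∀ j : ℤ, Q ≠ t ^ j) (j : ℤ) :
    Q⁻¹ * t⁻¹ ^ j ≠ 1 := by
  intro h
  apply hQ (-j)
  rw [zpow_neg, ← inv_zpow]
  exact ((inv_mul_eq_one₀ hQ0).mp h)

theorem crystalPure_eq {t Q : K} (ht0 : t ≠ 0) (ht : ∀ n : ℕ, 0 < n → t ^ n ≠ 1)
    (hQ0 : Q ≠ 0) (hQ : ∀ j : ℤ, Q ≠ t ^ j) :
    crystalPure t Q =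
      PowerSeries.mk (fun m => (∏ s ∈ Finset.Icc 1 m, (1 - t ^ (-(s : ℤ))))⁻¹) := by
  ext N
  rw [coeff_crystalPure, PowerSeries.coeff_mk, sum_crystalTerm (inv_ne_zero ht0)
    (inv_mul_cancel₀ hQ0) (fun n hn h => ht n hn (by simpa using h))
    (inv_mul_inv_zpow_ne_one hQ0 hQ) (mul_inv_zpow_ne_one ht0 hQ)]
  simp

/-! ### Limits of rational functions at `q = 0` -/

theorem TendsToAtZero.const (a : K) : TendsToAtZero (RatFunc.C a) a :=
  ⟨Polynomial.C a, 1, by simp, by simp [RatFunc.algebraMap_C], by simp⟩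

theorem TendsToAtZero.one : TendsToAtZero (1 : RatFunc K) 1 := by
  simpa using TendsToAtZero.const (1 : K)

theorem TendsToAtZero.zero : TendsToAtZero (0 : RatFunc K) 0 := by
  simpa using TendsToAtZero.const (0 : K)

theorem TendsToAtZero.X : TendsToAtZero (RatFunc.X : RatFunc K) 0 :=
  ⟨Polynomial.X, 1, by simp, by simp [RatFunc.algebraMap_X], by simp⟩

theorem algebraMap_ratFunc_ne_zero {b : Polynomial K} (hb : b.eval 0 ≠ 0) :
    algebraMap (Polynomial K) (RatFunc K) b ≠ 0 := by
  rw [Ne, FaithfulSMul.algebraMap_eq_zero_iff]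
  rintro rfl
  simp at hb

theorem TendsToAtZero.add {f g : RatFunc K} {c d : K} (hf : TendsToAtZero f c)
    (hg : TendsToAtZero g d) : TendsToAtZero (f + g) (c + d) := by
  obtain ⟨a, b, hb, rfl, rfl⟩ := hf
  obtain ⟨a', b', hb', rfl, rfl⟩ := hg
  refine ⟨a * b' + b * a', b * b', by simp [hb, hb'], ?_, ?_⟩
  · rw [div_add_div _ _ (algebraMap_ratFunc_ne_zero hb) (algebraMap_ratFunc_ne_zero hb')]
    simp
  · rw [div_add_div _ _ hb hb']
    simp

theorem TendsToAtZero.mul {f g : RatFunc K} {c d : K} (hf : TendsToAtZero f c)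
    (hg : TendsToAtZero g d) : TendsToAtZero (f * g) (c * d) := by
  obtain ⟨a, b, hb, rfl, rfl⟩ := hf
  obtain ⟨a', b', hb', rfl, rfl⟩ := hg
  refine ⟨a * a', b * b', by simp [hb, hb'], ?_, ?_⟩
  · rw [div_mul_div_comm]
    simp
  · rw [div_mul_div_comm]
    simp

theorem TendsToAtZero.sub {f g : RatFunc K} {c d : K} (hf : TendsToAtZero f c)
    (hg : TendsToAtZero g d) : TendsToAtZero (f - g) (c - d) := by
  simpa [sub_eq_add_neg] using hf.add ((TendsToAtZero.const (-1)).mul hg)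

theorem TendsToAtZero.inv {f : RatFunc K} {c : K} (hf : TendsToAtZero f c) (hc : c ≠ 0) :
    TendsToAtZero f⁻¹ c⁻¹ := by
  obtain ⟨a, b, hb, rfl, rfl⟩ := hf
  exact ⟨b, a, fun h => hc (by simp [h]), by simp, by simp⟩

theorem TendsToAtZero.pow {f : RatFunc K} {c : K} (hf : TendsToAtZero f c) (n : ℕ) :
    TendsToAtZero (f ^ n) (c ^ n) := by
  induction n with
  | zero => simpa using TendsToAtZero.one
  | succ n ih => simpa [pow_succ] using ih.mul hf

theorem TendsToAtZero.sum {ι : Type*} (s : Finset ι) {f : ι → RatFunc K} {c : ι → K}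
    (h : ∀ i ∈ s, TendsToAtZero (f i) (c i)) : TendsToAtZero (∑ i ∈ s, f i) (∑ i ∈ s, c i) := by
  classical
  induction s using Finset.induction_on with
  | empty => simpa using TendsToAtZero.zero
  | insert a s ha ih =>
    rw [Finset.sum_insert ha, Finset.sum_insert ha]
    exact (h a (by simp)).add (ih fun i hi => h i (by simp [hi]))

theorem TendsToAtZero.prod {ι : Type*} (s : Finset ι) {f : ι → RatFunc K} {c : ι → K}
    (h : ∀ i ∈ s, TendsToAtZero (f i) (c i)) : TendsToAtZero (∏ i ∈ s, f i) (∏ i ∈ s, c i) := by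
  classical
  induction s using Finset.induction_on with
  | empty => simpa using TendsToAtZero.one
  | insert a s ha ih =>
    rw [Finset.prod_insert ha, Finset.prod_insert ha]
    exact (h a (by simp)).mul (ih fun i hi => h i (by simp [hi]))

/-! ### The limit of the Nekrasov factors -/

theorem arm_nonneg {Y : YoungDiagram} {c : ℕ × ℕ} (hc : c ∈ Y.cells) : 0 ≤ arm Y c := by
  have : c.2 < Y.rowLen c.1 := YoungDiagram.mem_iff_lt_rowLen.mp (by simpa using hc)
  unfold arm
  omega

theorem leg_nonneg {Y : YoungDiagram} {c : ℕ × ℕ} (hc : c ∈ Y.cells) : 0 ≤ leg Y c := by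
  have : c.1 < Y.colLen c.2 := YoungDiagram.mem_iff_lt_colLen.mp (by simpa using hc)
  unfold leg
  omega

/-- The limit `q → 0` of `(t / q) ^ |W| / N_{Y W}(Q)`. -/
def nekrasovLimit (t : K) (Y W : YoungDiagram) (Q : K) : K :=
  (∏ c ∈ Y.cells, if arm Y c = 0 then (1 - Q * t ^ (leg W c + 1))⁻¹ else 1) *
    ∏ c ∈ W.cells, if arm W c = 0 then -(t ^ (leg Y c + 1) / Q) else 0

/-- Only the boxes of `W` carry negative powers of `q`; giving each of them one factor `t / q` makes
every box regular separately. -/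
theorem tendsToAtZero_nekrasovFactor {t : K} (ht0 : t ≠ 0) {Q : K} (hQ0 : Q ≠ 0)
    (Y W : YoungDiagram) (hQ : ∀ c ∈ Y.cells, Q * t ^ (leg W c + 1) ≠ 1) :
    TendsToAtZero ((RatFunc.C t / RatFunc.X) ^ W.card /
      nekrasovFactor RatFunc.X (RatFunc.C t) Y W (RatFunc.C Q)) (nekrasovLimit t Y W Q) := by
  have hX : (RatFunc.X : RatFunc K) ≠ 0 := RatFunc.X_ne_zero
  have e : (RatFunc.C t / RatFunc.X) ^ W.card /
      nekrasovFactor RatFunc.X (RatFunc.C t) Y W (RatFunc.C Q) =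
      (∏ c ∈ Y.cells, (1 - RatFunc.C Q * RatFunc.X ^ arm Y c * RatFunc.C t ^ (leg W c + 1))⁻¹) *
        ∏ c ∈ W.cells, (RatFunc.C t / RatFunc.X) *
          (1 - RatFunc.C Q * RatFunc.X ^ (-arm W c - 1) * RatFunc.C t ^ (-leg Y c))⁻¹ := by
    rw [Finset.prod_mul_distrib, Finset.prod_const, Finset.prod_inv_distrib,
      Finset.prod_inv_distrib, nekrasovFactor, div_eq_mul_inv, mul_inv]
    ring
  rw [e]
  refine TendsToAtZero.mul (TendsToAtZero.prod _ fun c hc => ?_)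
    (TendsToAtZero.prod _ fun c hc => ?_)
  · obtain ⟨a, ha⟩ := Int.eq_ofNat_of_zero_le (arm_nonneg hc)
    have h1 : TendsToAtZero
        (1 - RatFunc.C Q * RatFunc.X ^ arm Y c * RatFunc.C t ^ (leg W c + 1))
        (1 - Q * 0 ^ a * t ^ (leg W c + 1)) := by
      rw [ha, zpow_natCast, ← map_zpow₀]
      exact TendsToAtZero.one.sub (((TendsToAtZero.const Q).mul (TendsToAtZero.X.pow a)).mul
        (TendsToAtZero.const _))
    have h2 := h1.inv (by
      rcases Nat.eq_zero_or_pos a with rfl | h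
      · simpa using sub_ne_zero.mpr (hQ c hc).symm
      · simp [h.ne'])
    convert h2 using 1
    rw [ha]
    rcases Nat.eq_zero_or_pos a with rfl | h
    · simp
    · simp [h.ne']
  · obtain ⟨a, ha⟩ := Int.eq_ofNat_of_zero_le (arm_nonneg hc)
    -- With `q^{-a-1}` cleared, the box contributes `t q^a / (q^{a+1} - Q t^{-leg})`: the
    -- denominator is nonzero at `q = 0`, and the numerator survives only for `a = 0`.
    have h1 : TendsToAtZero (RatFunc.X ^ (a + 1) - RatFunc.C (Q * t ^ (-leg Y c)))
        (0 ^ (a + 1) - Q * t ^ (-leg Y c)) :=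
      (TendsToAtZero.X.pow _).sub (TendsToAtZero.const _)
    have h0 : (0 : K) ^ (a + 1) - Q * t ^ (-leg Y c) ≠ 0 := by
      simp [hQ0, zpow_ne_zero _ ht0]
    have h2 := ((TendsToAtZero.const t).mul (TendsToAtZero.X.pow a)).mul (h1.inv h0)
    convert h2 using 1
    · rw [map_mul, map_zpow₀, ha]
      have e2 : (RatFunc.X : RatFunc K) ^ (-(a : ℤ) - 1) = (RatFunc.X ^ (a + 1))⁻¹ := by
        rw [← zpow_natCast, ← zpow_neg]
        congr 1
        push_cast
        ring
      rw [e2]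
      have h3 : (RatFunc.X : RatFunc K) ^ (a + 1) ≠ 0 := pow_ne_zero _ hX
      have e3 : 1 - RatFunc.C Q * (RatFunc.X ^ (a + 1))⁻¹ * RatFunc.C t ^ (-leg Y c) =
          (RatFunc.X ^ (a + 1) - RatFunc.C Q * RatFunc.C t ^ (-leg Y c)) *
            (RatFunc.X ^ (a + 1))⁻¹ := by
        rw [sub_mul, mul_inv_cancel₀ h3]
        ring
      rw [e3, mul_inv, inv_inv, pow_succ]
      field_simp
    · rw [ha]
      rcases Nat.eq_zero_or_pos a with rfl | h
      · have := zpow_ne_zero (leg Y c) ht0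
        simp only [Nat.cast_zero, if_true, zero_add, pow_one, zero_sub, pow_zero, mul_one]
        rw [zpow_add_one₀ ht0, zpow_neg, inv_neg, mul_inv, inv_inv]
        ring
      · simp [h.ne']

/-- The Young diagram with a single column of `n` boxes. -/
def column (n : ℕ) : YoungDiagram where
  cells := Finset.range n ×ˢ {0}
  isLowerSet := by
    rintro ⟨i, j⟩ ⟨i', j'⟩ h hi
    simp only [Prod.mk_le_mk, Finset.coe_product, Finset.coe_range, Finset.coe_singleton,
      Set.mem_prod, Set.mem_Iio, Set.mem_singleton_iff] at *
    omega

theorem mem_column {n : ℕ} {c : ℕ × ℕ} : c ∈ column n ↔ c.1 < n ∧ c.2 = 0 := by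
  rw [← YoungDiagram.mem_cells]
  change c ∈ Finset.range n ×ˢ {0} ↔ _
  rw [Finset.mem_product, Finset.mem_range, Finset.mem_singleton]

theorem card_column (n : ℕ) : (column n).card = n := by
  simp [YoungDiagram.card, column]

theorem colLen_column (n : ℕ) : (column n).colLen 0 = n := by
  refine le_antisymm ?_ ?_
  · by_contra! h
    have := YoungDiagram.mem_iff_lt_colLen.mpr h
    simp [mem_column] at this
  · by_contra! h
    have : ((column n).colLen 0, 0) ∈ column n := by simpa [mem_column] using h
    exact lt_irrefl _ (YoungDiagram.mem_iff_lt_colLen.mp this)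

theorem rowLen_column {n i : ℕ} (h : i < n) : (column n).rowLen i = 1 := by
  have h0 : (i, 0) ∈ column n := by simpa [mem_column] using h
  have h1 : (i, 1) ∉ column n := by simp [mem_column]
  rw [YoungDiagram.mem_iff_lt_rowLen] at h0 h1
  omega

/-- Vanishing of the arm at the first box of a nonempty row forces that row to have length one. -/
theorem eq_column {Y : YoungDiagram} (h : ∀ c ∈ Y.cells, arm Y c = 0) : Y = column Y.card := by
  have h1 : ∀ i j, (i, j) ∈ Y → j = 0 := by
    intro i j hij
    have h0 : (i, 0) ∈ Y := Y.up_left_mem le_rfl (Nat.zero_le _) hij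
    have := h (i, 0) (by simpa using h0)
    rw [YoungDiagram.mem_iff_lt_rowLen] at hij
    simp only [arm] at this
    omega
  have h2 : Y = column (Y.colLen 0) := by
    refine YoungDiagram.ext (Finset.ext fun ⟨i, j⟩ => ?_)
    rw [YoungDiagram.mem_cells, YoungDiagram.mem_cells, mem_column,
      ← YoungDiagram.mem_iff_lt_colLen]
    constructor
    · intro hij
      obtain rfl := h1 i j hij
      exact ⟨hij, rfl⟩
    · rintro ⟨h3, h4⟩
      obtain rfl : j = 0 := h4
      exact h3
  rw [h2, card_column, ← h2]

theorem mem_youngDiagrams {n : ℕ} {Y : YoungDiagram} : Y ∈ youngDiagrams n ↔ Y.card = n := by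
  simp [youngDiagrams]

theorem nekrasovLimit_column (t Q : K) (n m : ℕ) :
    nekrasovLimit t (column n) (column m) Q =
      (∏ i ∈ Finset.range n, (1 - Q * t ^ ((m : ℤ) - i))⁻¹) *
        ∏ i ∈ Finset.range m, -(t ^ ((n : ℤ) - i) / Q) := by
  have harm : ∀ k i : ℕ, i < k → arm (column k) (i, 0) = 0 := by
    intro k i hi
    simp [arm, rowLen_column hi]
  have hleg : ∀ k i : ℕ, leg (column k) (i, 0) + 1 = (k : ℤ) - i := by
    intro k i
    simp only [leg, colLen_column]
    ring
  unfold nekrasovLimit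
  have hc : ∀ k, (column k).cells = Finset.range k ×ˢ {0} := fun _ => rfl
  rw [hc, hc, Finset.prod_product, Finset.prod_product]
  congr 1
  · refine Finset.prod_congr rfl fun i hi => ?_
    rw [Finset.prod_singleton, harm n i (Finset.mem_range.mp hi), hleg, if_pos rfl]
  · refine Finset.prod_congr rfl fun i hi => ?_
    rw [Finset.prod_singleton, harm m i (Finset.mem_range.mp hi), hleg, if_pos rfl]

theorem nekrasovLimit_eq_zero {t Q : K} {Y W : YoungDiagram} (h : W ≠ column W.card) :
    nekrasovLimit t Y W Q = 0 := by
  have : ∃ c ∈ W.cells, arm W c ≠ 0 := by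
    by_contra! h'
    exact h (eq_column h')
  obtain ⟨c, hc, hc'⟩ := this
  unfold nekrasovLimit
  rw [Finset.prod_eq_zero hc (by rw [if_neg hc']), mul_zero]

theorem sum_youngDiagrams_of_column {n : ℕ} (f : YoungDiagram → K)
    (h : ∀ Y ∈ youngDiagrams n, Y ≠ column n → f Y = 0) :
    ∑ Y ∈ youngDiagrams n, f Y = f (column n) :=
  Finset.sum_eq_single (column n) h fun h' => absurd (mem_youngDiagrams.mpr (card_column n)) h'

theorem inv_one_sub_inv {z : K} (hz : z ≠ 0) : (1 - z⁻¹)⁻¹ = (1 - z)⁻¹ * -z := by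
  have : 1 - z⁻¹ = (1 - z) * (-z)⁻¹ := by
    field_simp
    ring
  rw [this, mul_inv, inv_inv]

/-- The substitution `i = n - s` matches the boxes of a column with the factors, and the monomials
convert `(1 - z)⁻¹` into `(1 - z⁻¹)⁻¹`. -/
theorem crystalFactor_inv_eq_prod_range {t : K} (ht0 : t ≠ 0) {a : K} (ha : a ≠ 0) (n m : ℕ) :
    (crystalFactor t⁻¹ a⁻¹ n ((m : ℤ) - n))⁻¹ =
      (∏ i ∈ Finset.range n, (1 - 1 * t ^ ((n : ℤ) - i))⁻¹) *
        (∏ i ∈ Finset.range n, -(t ^ ((n : ℤ) - i) / 1)) *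
        (∏ i ∈ Finset.range n, (1 - a * t ^ ((m : ℤ) - i))⁻¹) *
        ∏ i ∈ Finset.range n, -(t ^ ((m : ℤ) - i) / a⁻¹) := by
  unfold crystalFactor
  rw [← Finset.prod_inv_distrib, ← Finset.prod_mul_distrib, ← Finset.prod_mul_distrib,
    ← Finset.prod_mul_distrib]
  refine Finset.prod_nbij' (fun s => n - s) (fun i => n - i) ?_ ?_ ?_ ?_ ?_
  · intro s hs
    simp at hs ⊢
    omega
  · intro s hs
    simp at hs ⊢
    omega
  · intro s hs
    simp at hs ⊢
    omega
  · intro s hs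
    simp at hs ⊢
    omega
  · intro s hs
    rw [Finset.mem_Icc] at hs
    have e1 : (n : ℤ) - ((n - s : ℕ) : ℤ) = s := by omega
    have e2 : (m : ℤ) - ((n - s : ℕ) : ℤ) = s + ((m : ℤ) - n) := by omega
    rw [e1, e2, inv_pow, inv_zpow, ← mul_inv a, mul_inv, inv_one_sub_inv (pow_ne_zero _ ht0),
      inv_one_sub_inv (mul_ne_zero ha (zpow_ne_zero _ ht0)), zpow_natCast, div_inv_eq_mul]
    ring

/-- The four limits give eight products: the four over the first column form one `crystalFactor`,
the four over the second column the other. -/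
theorem nekrasovLimit_columns {t Q : K} (ht0 : t ≠ 0) (hQ0 : Q ≠ 0) (n m : ℕ) :
    nekrasovLimit t (column n) (column n) 1 * nekrasovLimit t (column n) (column m) Q *
      nekrasovLimit t (column m) (column m) 1 * nekrasovLimit t (column m) (column n) Q⁻¹ =
      crystalTerm t⁻¹ Q⁻¹ Q n m := by
  have h1 := crystalFactor_inv_eq_prod_range ht0 hQ0 n m
  have h2 := crystalFactor_inv_eq_prod_range ht0 (inv_ne_zero hQ0) m n
  rw [inv_inv] at h2
  rw [crystalTerm, mul_inv, h1, h2]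
  simp only [nekrasovLimit_column]
  ring

theorem tendsToAtZero_nekrasovPure {t Q : K} (ht0 : t ≠ 0) (ht : ∀ n : ℕ, 0 < n → t ^ n ≠ 1)
    (hQ0 : Q ≠ 0) (hQ : ∀ j : ℤ, Q ≠ t ^ j) (N : ℕ) :
    TendsToAtZero
      (PowerSeries.coeff N
        (PowerSeries.rescale ((RatFunc.C t : RatFunc K) / RatFunc.X)
          (nekrasovPure (RatFunc.X : RatFunc K) (RatFunc.C t) (RatFunc.C Q))))
      (PowerSeries.coeff N (crystalPure t Q)) := by
  have hQ1 : ∀ j : ℤ, Q * t ^ j ≠ 1 := by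
    intro j
    simpa using mul_inv_zpow_ne_one ht0 hQ (-j)
  have hQ2 : ∀ j : ℤ, Q⁻¹ * t ^ j ≠ 1 := by
    intro j
    simpa using inv_mul_inv_zpow_ne_one hQ0 hQ (-j)
  have ht1 : ∀ (Y : YoungDiagram), ∀ c ∈ Y.cells, 1 * t ^ (leg Y c + 1) ≠ 1 := by
    intro Y c hc
    obtain ⟨a, ha⟩ := Int.eq_ofNat_of_zero_le (leg_nonneg hc)
    rw [ha, one_mul]
    exact_mod_cast ht (a + 1) (by omega)
  rw [PowerSeries.coeff_rescale, nekrasovPure, PowerSeries.coeff_mk, coeff_crystalPure,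
    Finset.mul_sum]
  refine TendsToAtZero.sum _ fun p hp => ?_
  rw [Finset.HasAntidiagonal.mem_antidiagonal] at hp
  have key : crystalTerm t⁻¹ Q⁻¹ Q p.1 p.2 = ∑ Y ∈ youngDiagrams p.1, ∑ W ∈ youngDiagrams p.2,
      nekrasovLimit t Y Y 1 * nekrasovLimit t Y W Q * nekrasovLimit t W W 1 *
        nekrasovLimit t W Y Q⁻¹ := by
    rw [sum_youngDiagrams_of_column, sum_youngDiagrams_of_column,
      nekrasovLimit_columns ht0 hQ0]
    · intro W hW hne
      rw [← mem_youngDiagrams.mp hW] at hne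
      rw [nekrasovLimit_eq_zero (Y := W) hne, mul_zero, zero_mul]
    · intro Y hY hne
      rw [← mem_youngDiagrams.mp hY] at hne
      refine Finset.sum_eq_zero fun W _ => ?_
      rw [nekrasovLimit_eq_zero (Y := Y) hne]
      simp
  rw [key, Finset.mul_sum]
  refine TendsToAtZero.sum _ fun Y hY => ?_
  rw [Finset.mul_sum]
  refine TendsToAtZero.sum _ fun W hW => ?_
  -- The rescaling doubles the power of `t / q` to `2 (|Y| + |W|)`, which is exactly what the four
  -- factors consume: `|Y|`, `|W|`, `|W|` and `|Y|`.
  have h := (((tendsToAtZero_nekrasovFactor ht0 one_ne_zero Y Y (ht1 Y)).mul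
    (tendsToAtZero_nekrasovFactor ht0 hQ0 Y W fun c _ => hQ1 _)).mul
    (tendsToAtZero_nekrasovFactor ht0 one_ne_zero W W (ht1 W))).mul
    (tendsToAtZero_nekrasovFactor ht0 (inv_ne_zero hQ0) W Y fun c _ => hQ2 _)
  convert h using 1
  rw [← hp, ← mem_youngDiagrams.mp hY, ← mem_youngDiagrams.mp hW, map_one, map_inv₀]
  generalize RatFunc.C t / RatFunc.X = z
  simp only [div_eq_mul_inv, mul_inv]
  ring

/-! ### Highest weight representations -/

theorem word_nil : word ([] : List ℤ) = (1 : Free K) := rfl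

theorem word_cons (n : ℤ) (w : List ℤ) : word (n :: w) = (T n * word w : Free K) := by
  simp [word]

theorem word_append (w w' : List ℤ) : word (w ++ w') = (word w * word w' : Free K) := by
  simp [word]

/-- The words span the free algebra. -/
theorem span_word : Submodule.span K (Set.range (word : List ℤ → Free K)) = ⊤ := by
  rw [eq_top_iff]
  rintro x -
  induction x using FreeAlgebra.induction with
  | grade0 r =>
    rw [Algebra.algebraMap_eq_smul_one]
    exact Submodule.smul_mem _ _ (Submodule.subset_span ⟨[], rfl⟩)
  | grade1 n => exact Submodule.subset_span ⟨[n], by simp [word, T]⟩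
  | mul a b ha hb =>
    have h : Submodule.span K (Set.range (word : List ℤ → Free K)) *
        Submodule.span K (Set.range (word : List ℤ → Free K)) ≤
        Submodule.span K (Set.range (word : List ℤ → Free K)) := by
      rw [Submodule.span_mul_span]
      refine Submodule.span_mono ?_
      rintro _ ⟨_, ⟨w, rfl⟩, _, ⟨w', rfl⟩, rfl⟩
      exact ⟨w ++ w', word_append w w'⟩
    exact h (Submodule.mul_mem_mul ha hb)
  | add a b ha hb => exact Submodule.add_mem _ ha hb

variable {V : Type*} [AddCommGroup V] [Module K V]

/-- A representation of the free algebra in which `v₀` is a highest weight vector of weight `h`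
and the relations of the crystallized deformed Virasoro algebra hold on words applied to `v₀`. -/
structure IsHighestWeight (t h : K) (ρ : Free K →ₐ[K] Module.End K V) (v₀ : V) : Prop where
  word_eq_zero : ∀ w : List ℤ, 0 < w.sum → ρ (word w) v₀ = 0
  weight : ρ (T 0) v₀ = h • v₀
  relator_eq_zero : ∀ (n m : ℤ) (N : ℕ) (w : List ℤ), m < n → 0 ≤ n + (N : ℤ) + w.sum →
    ρ (relator t n m N) (ρ (word w) v₀) = 0

/-- The span of the vectors obtained from `v₀` by applying `T_{-1}, …, T_{-n}`. -/
def lowered (ρ : Free K →ₐ[K] Module.End K V) (v₀ : V) (n : ℕ) : Submodule K V :=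
  Submodule.span K {v | ∃ w : List ℤ, (∀ a ∈ w, -(n : ℤ) ≤ a ∧ a < 0) ∧ v = ρ (word w) v₀}

section

variable {ρ : Free K →ₐ[K] Module.End K V} {v₀ : V}

theorem self_mem_lowered (n : ℕ) : v₀ ∈ lowered ρ v₀ n :=
  Submodule.subset_span ⟨[], by simp, by simp [word_nil]⟩

theorem map_word_cons (n : ℤ) (w : List ℤ) (v : V) :
    ρ (word (n :: w)) v = ρ (T n) (ρ (word w) v) := by
  rw [word_cons, map_mul, Module.End.mul_apply]

theorem apply_mem_lowered {n : ℕ} {a : ℤ} (h1 : -(n : ℤ) ≤ a) (h2 : a < 0) {v : V}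
    (hv : v ∈ lowered ρ v₀ n) : ρ (T a) v ∈ lowered ρ v₀ n := by
  have : lowered ρ v₀ n ≤ (lowered ρ v₀ n).comap (ρ (T a)) := by
    refine Submodule.span_le.mpr ?_
    rintro _ ⟨w, hw, rfl⟩
    refine Submodule.subset_span ⟨a :: w, ?_, (map_word_cons _ _ _).symm⟩
    intro b hb
    rcases List.mem_cons.mp hb with rfl | hb
    · exact ⟨h1, h2⟩
    · exact hw b hb
  exact this hv

theorem lowered_le {n : ℕ} {S : Submodule K V} (h0 : v₀ ∈ S)
    (h : ∀ a : ℤ, -(n : ℤ) ≤ a → a < 0 → ∀ v ∈ S, ρ (T a) v ∈ S) : lowered ρ v₀ n ≤ S := by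
  refine Submodule.span_le.mpr ?_
  rintro _ ⟨w, hw, rfl⟩
  induction w with
  | nil => simpa [word_nil] using h0
  | cons a w ih =>
    rw [map_word_cons]
    have ha := hw a (by simp)
    exact h a ha.1 ha.2 _ (ih fun b hb => hw b (by simp [hb]))

theorem lowered_mono : Monotone (lowered ρ v₀) := by
  intro n m h
  refine Submodule.span_mono ?_
  rintro _ ⟨w, hw, rfl⟩
  refine ⟨w, fun a ha => ⟨?_, (hw a ha).2⟩, rfl⟩
  have := (hw a ha).1
  omega

theorem lowered_zero : lowered ρ v₀ 0 ≤ Submodule.span K {v₀} :=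
  lowered_le (Submodule.mem_span_singleton_self _) fun a h1 h2 => by
    simp at h1
    omega

theorem mem_iSup_lowered {v : V} : v ∈ ⨆ n, lowered ρ v₀ n ↔ ∃ n, v ∈ lowered ρ v₀ n :=
  Submodule.mem_iSup_of_directed _ lowered_mono.directed_le

theorem neg_apply_mem_iSup_lowered {a : ℤ} (ha : a < 0) {v : V}
    (hv : v ∈ ⨆ n, lowered ρ v₀ n) : ρ (T a) v ∈ ⨆ n, lowered ρ v₀ n := by
  obtain ⟨n, hn⟩ := mem_iSup_lowered.mp hv
  refine mem_iSup_lowered.mpr ⟨max n a.natAbs, ?_⟩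
  exact apply_mem_lowered (by omega) ha (lowered_mono (le_max_left _ _) hn)

variable {t h : K}

namespace IsHighestWeight

theorem apply_comm (H : IsHighestWeight t h ρ v₀) {n m : ℤ} {N : ℕ} {w : List ℤ} (hnm : m < n)
    (hN : 0 ≤ n + (N : ℤ) + w.sum) :
    ρ (T n) (ρ (T m) (ρ (word w) v₀)) =
      ρ (T m) (ρ (T n) (ρ (word w) v₀)) + ρ (bracket t n m N) (ρ (word w) v₀) := by
  have := H.relator_eq_zero n m N w hnm hN
  rw [relator, map_sub, map_sub, map_mul, map_mul] at this
  simp only [LinearMap.sub_apply, Module.End.mul_apply] at this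
  rw [sub_eq_zero, sub_eq_iff_eq_add] at this
  rw [this, add_comm]

/-- The relation for `T_n T_m`, `n > 0 > m`. -/
theorem apply_pos_neg (H : IsHighestWeight t h ρ v₀) {n m : ℤ} {w : List ℤ} (hn : 0 < n) (hm : m < 0) {N : ℕ}
    (hN : 0 ≤ n + (N : ℤ) + w.sum) :
    ρ (T n) (ρ (T m) (ρ (word w) v₀)) =
      t⁻¹ • ρ (T m) (ρ (T n) (ρ (word w) v₀)) -
        (t - t⁻¹) • (∑ l ∈ Finset.Icc 1 N, t⁻¹ ^ l •
          ρ (T (m - (l : ℤ))) (ρ (T (n + (l : ℤ))) (ρ (word w) v₀))) +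
        (if n + m = 0 then (1 - t⁻¹) • ρ (word w) v₀ else 0) := by
  rw [H.apply_comm (by omega) hN, bracket, if_neg (by omega), if_neg (by omega),
    if_neg (by omega)]
  split_ifs
  · simp [tail, map_sum, LinearMap.sum_apply, Module.algebraMap_end_apply]
    module
  · simp [tail, map_sum, LinearMap.sum_apply]
    module

/-- The relation for `T_0 T_m`, `0 > m`. -/
theorem apply_zero_neg (H : IsHighestWeight t h ρ v₀) {m : ℤ} {w : List ℤ} (hm : m < 0) {N : ℕ}
    (hN : 0 ≤ (N : ℤ) + w.sum) :
    ρ (T 0) (ρ (T m) (ρ (word w) v₀)) =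
      ρ (T m) (ρ (T 0) (ρ (word w) v₀)) -
        (1 - t⁻¹) • (∑ l ∈ Finset.Icc 1 (-m).toNat,
          ρ (T (-(l : ℤ))) (ρ (T (m + (l : ℤ))) (ρ (word w) v₀))) -
        (t - t⁻¹) • (∑ l ∈ Finset.Icc 1 N, t⁻¹ ^ l •
          ρ (T (m - (l : ℤ))) (ρ (T (l : ℤ)) (ρ (word w) v₀))) := by
  rw [H.apply_comm hm (N := N) (by omega), bracket, if_neg (by omega), if_neg (by omega), if_pos rfl]
  simp [tail, map_sum, LinearMap.sum_apply]
  module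

/-- The relation for `T_n T_m`, `0 > n > m`. -/
theorem apply_neg_neg (H : IsHighestWeight t h ρ v₀) {n m : ℤ} (hn : n < 0) (hm : m < n)
    (w : List ℤ) :
    ρ (T n) (ρ (T m) (ρ (word w) v₀)) =
      ρ (T m) (ρ (T n) (ρ (word w) v₀)) -
        (1 - t⁻¹) • (∑ l ∈ Finset.Icc 1 (n - m).toNat,
          ρ (T (n - (l : ℤ))) (ρ (T (m + (l : ℤ))) (ρ (word w) v₀))) := by
  rw [H.apply_comm hm (N := n.natAbs + w.sum.natAbs) (by omega), bracket, if_pos (Or.inr hn)]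
  simp [map_sum, LinearMap.sum_apply]
  module

theorem pos_apply_self (H : IsHighestWeight t h ρ v₀) {n : ℤ} (hn : 0 < n) :
    ρ (T n) v₀ = 0 := by
  simpa [word] using H.word_eq_zero [n] (by simpa using hn)

/-- Normal ordering: the vectors obtained by applying lowering operators to the highest weight
vector span a subrepresentation. -/
theorem apply_mem_iSup_lowered (H : IsHighestWeight t h ρ v₀) (k : ℤ) {v : V}
    (hv : v ∈ ⨆ n, lowered ρ v₀ n) : ρ (T k) v ∈ ⨆ n, lowered ρ v₀ n := by
  obtain ⟨n, hn⟩ := mem_iSup_lowered.mp hv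
  suffices h : lowered ρ v₀ n ≤ (⨆ n, lowered ρ v₀ n).comap (ρ (T k)) from h hn
  refine Submodule.span_le.mpr ?_
  rintro _ ⟨w, hw, rfl⟩
  rw [SetLike.mem_coe, Submodule.mem_comap]
  -- Reordering `T_k T_m` with `m < 0 ≤ k` gives products `T_{m'} T_{k'}` with `m' < 0` and other
  -- indices `k'`, plus a central term; hence the induction on the word treats all `k` at once.
  have key : ∀ w : List ℤ, (∀ a ∈ w, a < 0) → ρ (word w) v₀ ∈ (⨆ n, lowered ρ v₀ n) ∧
      ∀ k : ℤ, ρ (T k) (ρ (word w) v₀) ∈ ⨆ n, lowered ρ v₀ n := by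
    intro w
    induction w with
    | nil =>
      intro _
      have h0 : v₀ ∈ ⨆ n, lowered ρ v₀ n := mem_iSup_lowered.mpr ⟨0, self_mem_lowered 0⟩
      simp only [word_nil, map_one, Module.End.one_apply]
      refine ⟨h0, fun k => ?_⟩
      rcases lt_trichotomy k 0 with hk | rfl | hk
      · exact neg_apply_mem_iSup_lowered hk h0
      · rw [H.weight]
        exact Submodule.smul_mem _ _ h0
      · rw [H.pos_apply_self hk]
        exact Submodule.zero_mem _
    | cons m w ih =>
      intro hmw
      obtain ⟨ih0, ih⟩ := ih fun a ha => hmw a (by simp [ha])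
      have hm : m < 0 := hmw m (by simp)
      rw [map_word_cons]
      have h1 := neg_apply_mem_iSup_lowered hm ih0
      refine ⟨h1, fun k => ?_⟩
      rcases lt_trichotomy k 0 with hk | rfl | hk
      · exact neg_apply_mem_iSup_lowered hk h1
      · rw [H.apply_zero_neg hm (N := w.sum.natAbs) (by omega)]
        refine Submodule.sub_mem _ (Submodule.sub_mem _ ?_ (Submodule.smul_mem _ _
          (Submodule.sum_mem _ fun l hl => ?_))) (Submodule.smul_mem _ _
          (Submodule.sum_mem _ fun l hl => Submodule.smul_mem _ _ ?_))
        · exact neg_apply_mem_iSup_lowered hm (ih _)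
        · exact neg_apply_mem_iSup_lowered (by simp at hl; omega) (ih _)
        · exact neg_apply_mem_iSup_lowered (by omega) (ih _)
      · rw [H.apply_pos_neg hk hm (N := w.sum.natAbs) (by omega)]
        refine Submodule.add_mem _ (Submodule.sub_mem _ (Submodule.smul_mem _ _ ?_)
          (Submodule.smul_mem _ _ (Submodule.sum_mem _ fun l hl =>
            Submodule.smul_mem _ _ ?_))) ?_
        · exact neg_apply_mem_iSup_lowered hm (ih _)
        · exact neg_apply_mem_iSup_lowered (by omega) (ih _)
        · split_ifs
          · exact Submodule.smul_mem _ _ ih0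
          · exact Submodule.zero_mem _
  exact (key w fun a ha => (hw a ha).2).2 k

/-- `T_p` kills the vectors obtained by applying `T_{-1}, …, T_{-n}`, if `p > n`. -/
theorem apply_eq_zero (H : IsHighestWeight t h ρ v₀) {n : ℕ} {p : ℤ} (hp : (n : ℤ) < p) {v : V}
    (hv : v ∈ lowered ρ v₀ n) : ρ (T p) v = 0 := by
  suffices h : lowered ρ v₀ n ≤ LinearMap.ker (ρ (T p)) from h hv
  refine Submodule.span_le.mpr ?_
  rintro _ ⟨w, hw, rfl⟩
  rw [SetLike.mem_coe, LinearMap.mem_ker]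
  induction w generalizing p with
  | nil => simpa [word_nil] using H.pos_apply_self (by omega)
  | cons m w ih =>
    -- After reordering, some `T_{p+l}` with `l ≥ 0` acts on the shorter word, and `p + m > 0`
    -- excludes the central term.
    have ih' := fun (p : ℤ) (hp : (n : ℤ) < p) => ih hp fun a ha => hw a (by simp [ha])
    have hm := hw m (by simp)
    rw [map_word_cons, H.apply_pos_neg (by omega) hm.2 (N := w.sum.natAbs) (by omega),
      if_neg (by omega), ih' p hp, Finset.sum_eq_zero]
    · simp
    · intro l _
      rw [ih' _ (by omega)]
      simp

/-- On the vectors obtained by applying `T_{-1}, …, T_{-n}`, the operators `T_n` and `T_{-n}`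
generate a deformed oscillator algebra. -/
theorem oscillator (H : IsHighestWeight t h ρ v₀) {n : ℕ} (hn : 0 < n) {v : V}
    (hv : v ∈ lowered ρ v₀ n) :
    ρ (T n) (ρ (T (-n)) v) = t⁻¹ • ρ (T (-n)) (ρ (T n) v) + (1 - t⁻¹) • v := by
  have : lowered ρ v₀ n ≤ LinearMap.eqLocus (ρ (T n) * ρ (T (-n)))
      (t⁻¹ • (ρ (T (-n)) * ρ (T n)) + (1 - t⁻¹) • LinearMap.id) := by
    refine Submodule.span_le.mpr ?_
    rintro _ ⟨w, hw, rfl⟩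
    rw [SetLike.mem_coe, LinearMap.mem_eqLocus]
    simp only [Module.End.mul_apply, LinearMap.add_apply, LinearMap.smul_apply, LinearMap.id_apply]
    rw [H.apply_pos_neg (by omega) (by omega) (N := w.sum.natAbs) (by omega),
      if_pos (by omega), Finset.sum_eq_zero]
    · simp
    · intro l hl
      rw [H.apply_eq_zero (n := n) (by simp at hl; omega) (Submodule.subset_span ⟨w, hw, rfl⟩)]
      simp
  exact this hv

theorem neg_neg_of_mem (H : IsHighestWeight t h ρ v₀) {n m : ℤ} (hn : n < 0) (hm : m < n) {k : ℕ}
    {v : V} (hv : v ∈ lowered ρ v₀ k) :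
    ρ (T n) (ρ (T m) v) = ρ (T m) (ρ (T n) v) -
        (1 - t⁻¹) • (∑ l ∈ Finset.Icc 1 (n - m).toNat,
          ρ (T (n - (l : ℤ))) (ρ (T (m + (l : ℤ))) v)) := by
  have : lowered ρ v₀ k ≤ LinearMap.eqLocus (ρ (T n) * ρ (T m))
      (ρ (T m) * ρ (T n) - (1 - t⁻¹) • (∑ l ∈ Finset.Icc 1 (n - m).toNat,
          ρ (T (n - (l : ℤ))) * ρ (T (m + (l : ℤ))))) := by
    refine Submodule.span_le.mpr ?_
    rintro _ ⟨w, hw, rfl⟩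
    rw [SetLike.mem_coe, LinearMap.mem_eqLocus]
    simp only [Module.End.mul_apply, LinearMap.sub_apply, LinearMap.smul_apply,
      LinearMap.sum_apply]
    exact H.apply_neg_neg hn hm w
  simpa using this hv

end IsHighestWeight

/-- The span of the vectors obtained by applying at most `k` times `T_{-(n+1)}` to vectors
obtained from `v₀` by applying `T_{-1}, …, T_{-n}`. -/
def filtration (ρ : Free K →ₐ[K] Module.End K V) (v₀ : V) (n : ℕ) : ℕ → Submodule K V
  | 0 => lowered ρ v₀ n
  | k + 1 => lowered ρ v₀ n ⊔ (filtration ρ v₀ n k).map (ρ (T (-(n + 1 : ℕ))))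

theorem filtration_mono (n : ℕ) : Monotone (filtration ρ v₀ n) := by
  refine monotone_nat_of_le_succ fun k => ?_
  induction k with
  | zero => exact le_sup_left
  | succ k ih => exact sup_le_sup_left (Submodule.map_mono ih) _

theorem filtration_le_lowered (n k : ℕ) : filtration ρ v₀ n k ≤ lowered ρ v₀ (n + 1) := by
  induction k with
  | zero => exact lowered_mono (Nat.le_succ n)
  | succ k ih =>
    refine sup_le (lowered_mono (Nat.le_succ n)) (Submodule.map_le_iff_le_comap.mpr ?_)
    intro v hv
    exact apply_mem_lowered (by omega) (by omega) (ih hv)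

theorem apply_mem_filtration_succ {n k : ℕ} {v : V} (hv : v ∈ filtration ρ v₀ n k) :
    ρ (T (-(n + 1 : ℕ))) v ∈ filtration ρ v₀ n (k + 1) :=
  Submodule.mem_sup_right (Submodule.mem_map_of_mem hv)

/-! ### Deformed oscillators and the determination of highest weight vectors -/

namespace IsHighestWeight

/-- Moving `T_a` past `T_{-(n+1)}` creates the products `T_{a-l} T_{-(n+1)+l}`. Among these
`T_{-(n+1)}` occurs only for the last `l`, and then once, as the left factor; so its number of
occurrences does not grow. -/
theorem apply_mem_filtration (H : IsHighestWeight t h ρ v₀) {n k : ℕ} {a : ℤ} (h1 : -(n : ℤ) ≤ a)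
    (h2 : a < 0) {v : V} (hv : v ∈ filtration ρ v₀ n k) : ρ (T a) v ∈ filtration ρ v₀ n k := by
  induction k generalizing a v with
  | zero => exact apply_mem_lowered h1 h2 hv
  | succ k ih =>
    obtain ⟨u, hu, _, ⟨u', hu', rfl⟩, rfl⟩ := Submodule.mem_sup.mp hv
    rw [map_add]
    refine Submodule.add_mem _ (Submodule.mem_sup_left (apply_mem_lowered h1 h2 hu)) ?_
    rw [H.neg_neg_of_mem h2 (by omega) (filtration_le_lowered n k hu')]
    refine Submodule.sub_mem _ (apply_mem_filtration_succ (ih h1 h2 hu'))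
      (Submodule.smul_mem _ _ (Submodule.sum_mem _ fun l hl => ?_))
    rw [Finset.mem_Icc] at hl
    by_cases hl' : a - (l : ℤ) = -(n + 1 : ℕ)
    · rw [hl']
      exact apply_mem_filtration_succ (ih (by omega) (by omega) hu')
    · exact filtration_mono n (Nat.le_succ k) (ih (by omega) (by omega)
        (ih (by omega) (by omega) hu'))

/-- The union of the filtration contains `v₀` and is stable under `T_{-1}, …, T_{-(n+1)}`: all
occurrences of `T_{-(n+1)}` can be moved to the left. -/
theorem lowered_succ_le_iSup_filtration (H : IsHighestWeight t h ρ v₀) (n : ℕ) :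
    lowered ρ v₀ (n + 1) ≤ ⨆ k, filtration ρ v₀ n k := by
  have hmem : ∀ v, v ∈ (⨆ k, filtration ρ v₀ n k) ↔ ∃ k, v ∈ filtration ρ v₀ n k := fun v =>
    Submodule.mem_iSup_of_directed _ (filtration_mono n).directed_le
  refine lowered_le ((hmem _).mpr ⟨0, self_mem_lowered n⟩) fun a h1 h2 v hv => ?_
  obtain ⟨k, hk⟩ := (hmem _).mp hv
  refine (hmem _).mpr ⟨k + 1, ?_⟩
  by_cases ha : a = -(n + 1 : ℕ)
  · rw [ha]
    exact apply_mem_filtration_succ hk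
  · exact filtration_mono n (Nat.le_succ k) (H.apply_mem_filtration (by omega) h2 hk)

theorem raise_filtration_zero (H : IsHighestWeight t h ρ v₀) {n : ℕ} {v : V}
    (hv : v ∈ filtration ρ v₀ n 0) : ρ (T (n + 1 : ℕ)) v = 0 :=
  H.apply_eq_zero (by omega) hv

/-- By the oscillator relation `T_{n+1}` removes one `T_{-(n+1)}`, and it kills whatever contains
none. -/
theorem raise_filtration_succ (H : IsHighestWeight t h ρ v₀) {n k : ℕ} {v : V}
    (hv : v ∈ filtration ρ v₀ n (k + 1)) : ρ (T (n + 1 : ℕ)) v ∈ filtration ρ v₀ n k := by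
  induction k generalizing v with
  | zero =>
    obtain ⟨u, hu, _, ⟨u', hu', rfl⟩, rfl⟩ := Submodule.mem_sup.mp hv
    rw [map_add, H.raise_filtration_zero hu, H.oscillator (by omega) (filtration_le_lowered n 0 hu'),
      H.raise_filtration_zero hu']
    simpa using Submodule.smul_mem _ _ hu'
  | succ k ih =>
    obtain ⟨u, hu, _, ⟨u', hu', rfl⟩, rfl⟩ := Submodule.mem_sup.mp hv
    rw [map_add, H.raise_filtration_zero hu, zero_add,
      H.oscillator (by omega) (filtration_le_lowered n _ hu')]
    exact Submodule.add_mem _ (Submodule.smul_mem _ _ (apply_mem_filtration_succ (ih hu')))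
      (Submodule.smul_mem _ _ hu')

/-- The eigenvalues of `T_{-n} T_n` are of the form `1 - t^{-s}`. -/
theorem eq_zero_of_eigenvector (H : IsHighestWeight t h ρ v₀) (ht0 : t ≠ 0) {n k : ℕ} {v : V} {e : K}
    (hv : v ∈ filtration ρ v₀ n k) (he : ∀ s : ℕ, e ≠ 1 - t⁻¹ ^ s)
    (hev : ρ (T (-(n + 1 : ℕ))) (ρ (T (n + 1 : ℕ)) v) = e • v) : v = 0 := by
  have he0 : e ≠ 0 := by simpa using he 0
  induction k generalizing v e with
  | zero =>
    rw [H.raise_filtration_zero hv, map_zero] at hev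
    exact (smul_eq_zero.mp hev.symm).resolve_left he0
  | succ k ih =>
    have h1 := H.raise_filtration_succ hv
    have h2 := H.oscillator (by omega : 0 < n + 1) (filtration_le_lowered n _ h1)
    rw [hev, map_smul] at h2
    have h3 : ρ (T (n + 1 : ℕ)) v = 0 := by
      -- `T_{n+1}` maps the eigenvector one step down the filtration and changes `e` into `t (e - (1
      -- - t⁻¹))`. This map sends `1 - t^{-(s+1)}` to `1 - t^{-s}`, so the excluded values stay
      -- excluded.
      refine ih (e := (e - (1 - t⁻¹)) * t) h1 ?_ ?_ ?_
      · intro s hs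
        apply he (s + 1)
        have : e = (e - (1 - t⁻¹)) * t * t⁻¹ + (1 - t⁻¹) := by
          rw [mul_inv_cancel_right₀ ht0]
          ring
        rw [this, hs, pow_succ]
        ring
      · have h4 : t⁻¹ • ρ (T (-(n + 1 : ℕ))) (ρ (T (n + 1 : ℕ)) (ρ (T (n + 1 : ℕ)) v)) =
            (e - (1 - t⁻¹)) • ρ (T (n + 1 : ℕ)) v := by
          rw [sub_smul, h2]
          abel
        rw [mul_comm, mul_smul, ← h4, smul_smul, mul_inv_cancel₀ ht0, one_smul]
      · have := he 1
        rw [pow_one] at this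
        exact mul_ne_zero (sub_ne_zero.mpr this) ht0
    rw [h3, map_zero] at hev
    exact (smul_eq_zero.mp hev.symm).resolve_left he0

/-- Write `v = u + T_{-(n+1)} u'` with `u` free of `T_{-(n+1)}`. Then `T_{n+1} v = 0` makes `u'`
satisfy the eigenvector equation of `T_{-(n+1)} T_{n+1}` for `1 - t`. Since `1 - t = 1 - t^{-s}`
would mean `t^{s+1} = 1`, it follows that `u' = 0`. -/
theorem mem_lowered_of_raise_eq_zero (H : IsHighestWeight t h ρ v₀) (ht0 : t ≠ 0)
    (ht : ∀ n : ℕ, 0 < n → t ^ n ≠ 1) {n : ℕ} {v : V} (hv : v ∈ lowered ρ v₀ (n + 1))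
    (h0 : ρ (T (n + 1 : ℕ)) v = 0) : v ∈ lowered ρ v₀ n := by
  obtain ⟨k, hk⟩ := (Submodule.mem_iSup_of_directed _ (filtration_mono n).directed_le).mp
    (H.lowered_succ_le_iSup_filtration n hv)
  cases k with
  | zero => exact hk
  | succ k =>
    obtain ⟨u, hu, _, ⟨u', hu', rfl⟩, rfl⟩ := Submodule.mem_sup.mp hk
    rw [map_add, H.raise_filtration_zero hu, zero_add,
      H.oscillator (by omega) (filtration_le_lowered n _ hu')] at h0
    have h1 : u' = 0 := by
      refine H.eq_zero_of_eigenvector ht0 (e := 1 - t) hu' ?_ ?_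
      · intro s hs
        apply ht (s + 1) (by omega)
        have h2 : t = t⁻¹ ^ s := by linear_combination -hs
        rw [pow_succ]
        nth_rw 2 [h2]
        rw [← mul_pow, mul_inv_cancel₀ ht0, one_pow]
      · have h3 := congrArg (fun x => t • x) h0
        simp only [smul_add, smul_smul, mul_inv_cancel₀ ht0, one_smul, smul_zero] at h3
        rw [eq_neg_of_add_eq_zero_left h3, ← neg_smul]
        congr 1
        rw [mul_sub, mul_inv_cancel₀ ht0]
        ring
    rw [h1, map_zero, add_zero]
    exact hu

/-- A highest weight vector is a multiple of `v₀`. -/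
theorem mem_span_of_forall_apply_eq_zero (H : IsHighestWeight t h ρ v₀) (ht0 : t ≠ 0)
    (ht : ∀ n : ℕ, 0 < n → t ^ n ≠ 1) {v : V} (hv : v ∈ ⨆ n, lowered ρ v₀ n)
    (h0 : ∀ n : ℤ, 0 < n → ρ (T n) v = 0) : v ∈ Submodule.span K {v₀} := by
  obtain ⟨n, hn⟩ := mem_iSup_lowered.mp hv
  induction n with
  | zero => exact lowered_zero hn
  | succ n ih => exact ih (H.mem_lowered_of_raise_eq_zero ht0 ht hn (h0 _ (by omega)))

end IsHighestWeight
end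

end

/-! ### The Fock space -/

section Fock

variable {L : Type*} [Field L]

/-- The geometric series `∑ aⁿ xⁿ`. -/
def geom (a : L) : PowerSeries L := PowerSeries.mk fun n => a ^ n

/-- The linear polynomial `1 - a x`. -/
def oneSub (a : L) : PowerSeries L := 1 - PowerSeries.C a * PowerSeries.X

theorem oneSub_mul_geom (a : L) : oneSub a * geom a = 1 := by
  ext n
  rw [oneSub, sub_mul, one_mul, map_sub, mul_assoc, PowerSeries.coeff_C_mul]
  cases n with
  | zero => simp [geom]
  | succ n => simp [geom, PowerSeries.coeff_succ_X_mul, pow_succ', PowerSeries.coeff_one]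

/-- The contraction functions: the numerator parameter. -/
def contrNum (c : L) (b : Bool) : L := if b then 1 else c

/-- The contraction functions: the denominator parameter. -/
def contrDen (c : L) (b : Bool) : L := if b then c else 1

/-- The contraction function of two vertex operators of equal (`b = true`) or opposite
(`b = false`) charge: `(1 - x) / (1 - c x)` or its inverse. -/
def contr (c : L) (b : Bool) : PowerSeries L := oneSub (contrNum c b) * geom (contrDen c b)

theorem oneSub_mul_contr (c : L) (b : Bool) :
    oneSub (contrDen c b) * contr c b = oneSub (contrNum c b) := by
  rw [contr, mul_left_comm, oneSub_mul_geom, mul_one]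

theorem contr_mul_contr_not (c : L) (b : Bool) : contr c b * contr c (!b) = 1 := by
  have h : contrNum c (!b) = contrDen c b := by cases b <;> rfl
  have h' : contrDen c (!b) = contrNum c b := by cases b <;> rfl
  rw [contr, contr, h, h']
  calc _ = (oneSub (contrNum c b) * geom (contrNum c b)) *
        (oneSub (contrDen c b) * geom (contrDen c b)) := by ring
    _ = 1 := by rw [oneSub_mul_geom, oneSub_mul_geom, one_mul]

theorem constantCoeff_contr (c : L) (b : Bool) : PowerSeries.coeff 0 (contr c b) = 1 := by
  simp [contr, oneSub, geom]

variable (L) in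
/-- The Fock space, a polynomial ring in infinitely many variables. -/
abbrev Fock : Type _ := MvPolynomial ℕ L

variable (L) in
/-- The generating function `1 + ∑ x_n wⁿ` and its inverse. -/
def creation : Bool → PowerSeries (Fock L)
  | true => PowerSeries.mk fun n => Nat.casesOn n 1 fun k => MvPolynomial.X k
  | false => PowerSeries.invOfUnit
      (PowerSeries.mk fun n => Nat.casesOn n 1 fun k => MvPolynomial.X k) 1

theorem creation_mul_creation_not (b : Bool) : creation L b * creation L (!b) = 1 := by
  have h : creation L true * creation L false = 1 :=
    PowerSeries.mul_invOfUnit _ _ (by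
      rw [← PowerSeries.coeff_zero_eq_constantCoeff_apply]
      exact PowerSeries.coeff_mk 0 _)
  cases b
  · rw [mul_comm]
    exact h
  · exact h

theorem coeff_zero_creation (b : Bool) : PowerSeries.coeff 0 (creation L b) = 1 := by
  cases b
  · simp [creation]
  · exact PowerSeries.coeff_mk 0 _

/-- `f(x) ↦ f(u w)`, as a power series in `w` with coefficients in `A[u]`. -/
def twist (A : Type*) [CommRing A] [Algebra L A] : PowerSeries L →+* PowerSeries (Polynomial A) :=
  (PowerSeries.rescale (Polynomial.X : Polynomial A)).comp
    (PowerSeries.map (algebraMap L (Polynomial A)))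

theorem coeff_twist (A : Type*) [CommRing A] [Algebra L A] (f : PowerSeries L) (n : ℕ) :
    PowerSeries.coeff n (twist A f) =
      Polynomial.X ^ n * Polynomial.C (algebraMap L A (PowerSeries.coeff n f)) := by
  simp [twist, PowerSeries.coeff_rescale, Polynomial.algebraMap_apply]

/-- The annihilation part of a vertex operator of charge `ε`: the algebra homomorphism that
multiplies the creation series by a contraction function. -/
def annihilation (c : L) (ε : Bool) : Fock L →ₐ[L] Polynomial (Fock L) :=
  MvPolynomial.aeval fun n => PowerSeries.coeff (n + 1)
    (twist (Fock L) (contr c ε) * PowerSeries.map Polynomial.C (creation L true))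

theorem map_annihilation_creation_true (c : L) (ε : Bool) :
    PowerSeries.map (annihilation c ε : Fock L →+* Polynomial (Fock L)) (creation L true) =
      twist (Fock L) (contr c ε) * PowerSeries.map Polynomial.C (creation L true) := by
  ext1 n
  rw [PowerSeries.coeff_map]
  cases n with
  | zero =>
    simp [coeff_zero_creation, PowerSeries.coeff_mul, coeff_twist, constantCoeff_contr,
      -PowerSeries.coeff_zero_eq_constantCoeff]
  | succ n =>
    rw [creation, PowerSeries.coeff_mk, AlgHom.coe_toRingHom]
    exact MvPolynomial.aeval_X _ n

/-- For `η = false` the series is the inverse of the one for `true`, and the contraction functions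
of opposite charge are inverse as well. -/
theorem map_annihilation_creation (c : L) (ε η : Bool) :
    PowerSeries.map (annihilation c ε : Fock L →+* Polynomial (Fock L)) (creation L η) =
      twist (Fock L) (contr c (ε == η)) * PowerSeries.map Polynomial.C (creation L η) := by
  cases η
  · have h1 := congrArg (PowerSeries.map (annihilation c ε : Fock L →+* Polynomial (Fock L)))
      (creation_mul_creation_not (L := L) true)
    have h2 := congrArg (PowerSeries.map (Polynomial.C : Fock L →+* Polynomial (Fock L)))
      (creation_mul_creation_not (L := L) true)
    have h3 := congrArg (twist (Fock L)) (contr_mul_contr_not c ε)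
    have e : (ε == false) = !ε := by cases ε <;> rfl
    rw [map_mul, map_one, map_annihilation_creation_true, Bool.not_true] at h1
    rw [map_mul, map_one, Bool.not_true] at h2
    rw [map_mul, map_one] at h3
    rw [e]
    generalize PowerSeries.map (annihilation c ε : Fock L →+* Polynomial (Fock L))
      (creation L false) = A at *
    generalize twist (Fock L) (contr c ε) = B at *
    generalize twist (Fock L) (contr c !ε) = B' at *
    generalize PowerSeries.map Polynomial.C (creation L true) = C at *
    generalize PowerSeries.map Polynomial.C (creation L false) = C' at *
    calc A = A * ((B * B') * (C * C')) := by rw [h2, h3, one_mul, mul_one]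
      _ = (B * C * A) * (B' * C') := by ring
      _ = B' * C' := by rw [h1, one_mul]
  · rw [map_annihilation_creation_true]
    cases ε <;> rfl

/-- The coefficients of the creation series, extended by zero. -/
def mode (ε : Bool) (n : ℤ) : Fock L :=
  if n < 0 then 0 else PowerSeries.coeff n.toNat (creation L ε)

theorem mode_of_neg (ε : Bool) {n : ℤ} (h : n < 0) : (mode ε n : Fock L) = 0 := if_pos h

theorem mode_natCast (ε : Bool) (n : ℕ) :
    (mode ε n : Fock L) = PowerSeries.coeff n (creation L ε) := by
  rw [mode, if_neg (by omega), Int.toNat_natCast]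

/-- The contraction with its denominator cleared: each coefficient then involves only two terms, and
no infinite sums of modes arise. -/
theorem annihilation_mode (c : L) (ε η : Bool) (k : ℤ) :
    annihilation c ε (mode η k) -
        Polynomial.C (MvPolynomial.C (contrDen c (ε == η))) *
          (Polynomial.X * annihilation c ε (mode η (k - 1))) =
      Polynomial.C (mode η k) - Polynomial.C (MvPolynomial.C (contrNum c (ε == η))) *
        (Polynomial.X * Polynomial.C (mode η (k - 1))) := by
  rcases lt_or_ge k 0 with hk | hk
  · simp [mode_of_neg _ hk, mode_of_neg _ (by omega : k - 1 < 0)]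
  obtain ⟨n, rfl⟩ := Int.eq_ofNat_of_zero_le hk
  have h := congrArg (fun f => twist (Fock L) (oneSub (contrDen c (ε == η))) * f)
    (map_annihilation_creation c ε η)
  rw [← mul_assoc, ← map_mul, oneSub_mul_contr] at h
  have ht : ∀ a : L, twist (Fock L) (oneSub a) =
      1 - PowerSeries.C (Polynomial.C (MvPolynomial.C a) * Polynomial.X) * PowerSeries.X := by
    intro a
    have hC : ∀ x : Polynomial (Fock L),
        PowerSeries.rescale Polynomial.X (PowerSeries.C x) = PowerSeries.C x := by
      intro x
      ext1 k
      rw [PowerSeries.coeff_rescale, PowerSeries.coeff_C]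
      split_ifs with hk
      · rw [hk, pow_zero, one_mul]
      · rw [mul_zero]
    simp [twist, oneSub, PowerSeries.rescale_X, Polynomial.algebraMap_apply, hC, mul_assoc]
  rw [ht, ht, sub_mul, sub_mul, one_mul, one_mul, mul_assoc, mul_assoc] at h
  have h' := congrArg (PowerSeries.coeff n) h
  rw [map_sub, map_sub, PowerSeries.coeff_C_mul, PowerSeries.coeff_C_mul] at h'
  cases n with
  | zero =>
    have e : ∀ η, (mode η (((0 : ℕ) : ℤ) - 1) : Fock L) = 0 := fun η => mode_of_neg _ (by omega)
    rw [e, mode_natCast]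
    simpa using h'
  | succ n =>
    have e : (((n + 1 : ℕ) : ℤ) - 1) = n := by omega
    rw [e, mode_natCast, mode_natCast]
    rw [PowerSeries.coeff_succ_X_mul, PowerSeries.coeff_succ_X_mul] at h'
    simpa [mul_assoc] using h'

/-- The coefficient extraction `P(u) ↦ [zⁿ] creation(z) P(1/z)`. -/
def extract (ε : Bool) (n : ℤ) : Polynomial (Fock L) →ₗ[Fock L] Fock L :=
  Polynomial.lsum fun j => (mode ε (n + j) : Fock L) • LinearMap.id

theorem extract_monomial (ε : Bool) (n : ℤ) (j : ℕ) (x : Fock L) :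
    extract ε n (Polynomial.monomial j x) = mode ε (n + j) * x := by
  simp [extract, Polynomial.lsum_apply]

theorem extract_X_mul (ε : Bool) (n : ℤ) (P : Polynomial (Fock L)) :
    extract ε n (Polynomial.X * P) = extract ε (n + 1) P := by
  induction P using Polynomial.induction_on' with
  | add p q hp hq => rw [mul_add, map_add, map_add, hp, hq]
  | monomial j x =>
    rw [Polynomial.X_mul_monomial, extract_monomial, extract_monomial]
    congr 2
    push_cast
    ring

theorem extract_C_mul (ε : Bool) (n : ℤ) (x : Fock L) (P : Polynomial (Fock L)) :
    extract ε n (Polynomial.C x * P) = x * extract ε n P := by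
  rw [← Polynomial.smul_eq_C_mul, map_smul, smul_eq_mul]

/-- The modes of the vertex operator of charge `ε`. -/
def vertex (c : L) (ε : Bool) (n : ℤ) : Module.End L (Fock L) :=
  (extract ε n).restrictScalars L ∘ₗ (annihilation c ε).toLinearMap

theorem vertex_apply (c : L) (ε : Bool) (n : ℤ) (f : Fock L) :
    vertex c ε n f = extract ε n (annihilation c ε f) := rfl

/-- Coefficient extraction in two variables. -/
def extract₂ (ε η : Bool) (m n : ℤ) : Polynomial (Polynomial (Fock L)) →ₗ[Fock L] Fock L :=
  Polynomial.lsum fun j => (mode η (n + j) : Fock L) • extract ε m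

theorem extract₂_monomial (ε η : Bool) (m n : ℤ) (j : ℕ) (P : Polynomial (Fock L)) :
    extract₂ ε η m n (Polynomial.monomial j P) = mode η (n + j) * extract ε m P := by
  simp [extract₂, Polynomial.lsum_apply]

/-- The modes of the normally ordered product of two vertex operators. -/
def normalProduct (c : L) (ε η : Bool) (m n : ℤ) (f : Fock L) : Fock L :=
  extract₂ ε η m n ((annihilation c η f).map (annihilation c ε : Fock L →+* Polynomial (Fock L)))

/-- The operator product of two vertex operators. -/
theorem vertex_vertex (c : L) (ε η : Bool) (m n : ℤ) (f : Fock L) :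
    vertex c ε m (vertex c η n f) -
        contrDen c (ε == η) • vertex c ε (m + 1) (vertex c η (n - 1) f) =
      normalProduct c ε η m n f -
        contrNum c (ε == η) • normalProduct c ε η (m + 1) (n - 1) f := by
  simp only [vertex_apply, normalProduct]
  generalize annihilation c η f = P
  induction P using Polynomial.induction_on' with
  | add p q hp hq =>
    simp only [map_add, Polynomial.map_add, smul_add]
    linear_combination hp + hq
  | monomial j x =>
    -- Under `extract`, multiplication by the polynomial variable becomes the shift `m ↦ m + 1`.
    have h := congrArg (fun y => extract ε m (y * annihilation c ε x))
      (annihilation_mode c ε η (n + j))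
    simp only [sub_mul, map_sub, mul_assoc, extract_C_mul, extract_X_mul] at h
    have e : n - 1 + (j : ℤ) = n + j - 1 := by ring
    rw [Polynomial.map_monomial, extract_monomial, extract_monomial, extract₂_monomial,
      extract₂_monomial, map_mul (annihilation c ε), map_mul (annihilation c ε), e]
    simpa [MvPolynomial.smul_eq_C_mul] using h

/-- Two ring homomorphisms from the Fock space agree if they agree on constants and on the
creation series. -/
theorem fock_ringHom_ext {A : Type*} [CommRing A] {φ ψ : Fock L →+* A}
    (hC : ∀ a : L, φ (MvPolynomial.C a) = ψ (MvPolynomial.C a))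
    (h : PowerSeries.map φ (creation L true) = PowerSeries.map ψ (creation L true)) : φ = ψ := by
  refine MvPolynomial.ringHom_ext hC fun n => ?_
  have := congrArg (PowerSeries.coeff (n + 1)) h
  simpa only [PowerSeries.coeff_map, creation, PowerSeries.coeff_mk] using this

/-! ### Normally ordered products: symmetry and the delta function -/

theorem map_twist {A B : Type*} [CommRing A] [Algebra L A] [CommRing B] [Algebra L B]
    (φ : A →ₐ[L] B) (f : PowerSeries L) :
    PowerSeries.map (Polynomial.mapRingHom (φ : A →+* B)) (twist A f) = twist B f := by
  ext1 n
  rw [PowerSeries.coeff_map, coeff_twist, coeff_twist]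
  simp

/-- The composite of two annihilation parts. -/
def annihilation₂ (c : L) (ε η : Bool) : Fock L →ₐ[L] Polynomial (Polynomial (Fock L)) :=
  (Polynomial.mapAlgHom (annihilation c ε)).comp (annihilation c η)

theorem normalProduct_eq (c : L) (ε η : Bool) (m n : ℤ) (f : Fock L) :
    normalProduct c ε η m n f = extract₂ ε η m n (annihilation₂ c ε η f) := rfl

theorem map_annihilation₂_creation (c : L) (ε η : Bool) :
    PowerSeries.map (annihilation₂ c ε η : Fock L →+* Polynomial (Polynomial (Fock L)))
        (creation L true) =
      twist (Polynomial (Fock L)) (contr c η) *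
        PowerSeries.map Polynomial.C (twist (Fock L) (contr c ε) *
          PowerSeries.map Polynomial.C (creation L true)) := by
  have h : (annihilation₂ c ε η : Fock L →+* Polynomial (Polynomial (Fock L))) =
      (Polynomial.mapRingHom (annihilation c ε : Fock L →+* Polynomial (Fock L))).comp
        (annihilation c η : Fock L →+* Polynomial (Fock L)) := rfl
  rw [h, PowerSeries.map_comp, RingHom.comp_apply, map_annihilation_creation_true, map_mul,
    map_twist, ← map_annihilation_creation_true, ← RingHom.comp_apply, ← PowerSeries.map_comp,
    ← RingHom.comp_apply, ← PowerSeries.map_comp]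
  have e : (Polynomial.mapRingHom (annihilation c ε : Fock L →+* Polynomial (Fock L))).comp
      Polynomial.C = Polynomial.C.comp (annihilation c ε : Fock L →+* Polynomial (Fock L)) :=
    RingHom.ext fun x => by simp
  rw [e]

/-- Either composite multiplies the creation series by one contraction function in each variable,
and exchanging the variables only permutes these commuting factors. The resulting symmetry of
normally ordered products is what yields exchange relations. -/
theorem swap_annihilation₂ (c : L) (ε η : Bool) (f : Fock L) :
    Polynomial.Bivariate.swap (annihilation₂ c ε η f) = annihilation₂ c η ε f := by
  have : (RingHomClass.toRingHom (Polynomial.Bivariate.swap (R := Fock L)) :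
      Polynomial (Polynomial (Fock L)) →+* Polynomial (Polynomial (Fock L))).comp
      (annihilation₂ c ε η : Fock L →+* Polynomial (Polynomial (Fock L))) =
      (annihilation₂ c η ε : Fock L →+* Polynomial (Polynomial (Fock L))) := by
    refine fock_ringHom_ext (A := Polynomial (Polynomial (Fock L))) (fun a => ?_) ?_
    · simp [Polynomial.Bivariate.swap_C_C]
    rw [PowerSeries.map_comp, RingHom.comp_apply, map_annihilation₂_creation,
      map_annihilation₂_creation, map_mul, map_mul, map_mul, map_mul, mul_left_comm]
    refine congrArg₂ (· * ·) ?_ (congrArg₂ (· * ·) ?_ ?_) <;> ext1 n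
    · simp [coeff_twist, Polynomial.algebraMap_apply, Polynomial.Bivariate.swap_C_C,
        Polynomial.Bivariate.swap_Y]
    · simp [coeff_twist, Polynomial.algebraMap_apply, Polynomial.Bivariate.swap_C_C,
        Polynomial.Bivariate.swap_X]
    · simp [Polynomial.Bivariate.swap_C_C]
  exact RingHom.congr_fun this f

theorem extract₂_swap (ε η : Bool) (m n : ℤ) (P : Polynomial (Polynomial (Fock L))) :
    extract₂ η ε n m (Polynomial.Bivariate.swap P) = extract₂ ε η m n P := by
  induction P using Polynomial.induction_on' with
  | add p q hp hq => rw [map_add, map_add, map_add, hp, hq]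
  | monomial j p =>
    induction p using Polynomial.induction_on' with
    | add p q hp hq => rw [map_add, map_add, map_add, map_add, hp, hq]
    | monomial i x =>
      rw [Polynomial.Bivariate.swap_monomial_monomial, extract₂_monomial, extract₂_monomial,
        extract_monomial, extract_monomial]
      ring

theorem normalProduct_comm (c : L) (ε η : Bool) (m n : ℤ) (f : Fock L) :
    normalProduct c ε η m n f = normalProduct c η ε n m f := by
  rw [normalProduct_eq, normalProduct_eq, ← swap_annihilation₂ c ε η, extract₂_swap]

/-- The annihilation parts of opposite charge cancel. -/
theorem eval_annihilation₂ (c : L) (f : Fock L) :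
    Polynomial.eval Polynomial.X (annihilation₂ c true false f) = Polynomial.C f := by
  have : (Polynomial.evalRingHom (Polynomial.X : Polynomial (Fock L))).comp
      (annihilation₂ c true false : Fock L →+* Polynomial (Polynomial (Fock L))) =
      Polynomial.C := by
    refine fock_ringHom_ext (fun a => ?_) ?_
    · simp
    rw [PowerSeries.map_comp, RingHom.comp_apply, map_annihilation₂_creation, map_mul]
    have e1 : ∀ x : PowerSeries (Polynomial (Fock L)),
        PowerSeries.map (Polynomial.evalRingHom (Polynomial.X : Polynomial (Fock L)))
          (PowerSeries.map Polynomial.C x) = x := by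
      intro x
      ext1 n
      simp [PowerSeries.coeff_map]
    have e2 : PowerSeries.map (Polynomial.evalRingHom (Polynomial.X : Polynomial (Fock L)))
        (twist (Polynomial (Fock L)) (contr c false)) = twist (Fock L) (contr c false) := by
      ext1 n
      simp [coeff_twist, PowerSeries.coeff_map, Polynomial.algebraMap_apply]
    rw [e1, e2, ← mul_assoc, ← map_mul]
    have h := contr_mul_contr_not c false
    rw [Bool.not_false] at h
    rw [h, map_one, one_mul]
  exact RingHom.congr_fun this f

theorem vertex_eq_zero (c : L) (ε : Bool) {n : ℤ} {f : Fock L}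
    (h : n + (annihilation c ε f).natDegree < 0) : vertex c ε n f = 0 := by
  rw [vertex_apply, extract, Polynomial.lsum_apply]
  refine Finset.sum_eq_zero fun j hj => ?_
  have := Polynomial.le_natDegree_of_mem_supp j hj
  simp only
  rw [mode_of_neg _ (by omega), zero_smul, LinearMap.zero_apply]

/-- The bound is uniform in `m`; together with the symmetry it makes the sums over `m + n` fixed
finite at both ends. -/
theorem exists_normalProduct_eq_zero (c : L) (ε η : Bool) (f : Fock L) :
    ∃ B : ℕ, ∀ m n : ℤ, n < -(B : ℤ) → normalProduct c ε η m n f = 0 := by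
  refine ⟨(annihilation₂ c ε η f).natDegree, fun m n h => ?_⟩
  rw [normalProduct_eq, extract₂, Polynomial.lsum_apply]
  refine Finset.sum_eq_zero fun j hj => ?_
  have := Polynomial.le_natDegree_of_mem_supp j hj
  simp only
  rw [mode_of_neg _ (by omega), zero_smul, LinearMap.zero_apply]

/-- A coefficient of the creation series times its inverse; the bounds on `R` ensure that the window
holds all pairs of nonnegative indices. -/
theorem sum_mode_mul_mode (a b : ℤ) (R : ℕ) (ha : -(R : ℤ) ≤ -a) (hb : b ≤ R) :
    ∑ i ∈ Finset.Icc (-(R : ℤ)) R, (mode true (a + i) : Fock L) * mode false (b - i) =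
      if a + b = 0 then 1 else 0 := by
  rcases lt_or_ge (a + b) 0 with h | h
  · rw [if_neg h.ne]
    refine Finset.sum_eq_zero fun i _ => ?_
    rcases lt_or_ge (a + i) 0 with h' | h'
    · rw [mode_of_neg _ h', zero_mul]
    · rw [mode_of_neg false (by omega), mul_zero]
  obtain ⟨n, hn⟩ := Int.eq_ofNat_of_zero_le h
  have h1 := congrArg (PowerSeries.coeff n) (creation_mul_creation_not (L := L) true)
  rw [Bool.not_true, PowerSeries.coeff_mul, PowerSeries.coeff_one] at h1
  have h2 : (if a + b = 0 then (1 : Fock L) else 0) = if n = 0 then 1 else 0 := by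
    congr 1
    exact propext (by omega)
  rw [h2, ← h1]
  symm
  refine Finset.sum_of_injOn (fun p => (p.1 : ℤ) - a) ?_ ?_ ?_ ?_
  · rintro ⟨i, j⟩ hp ⟨i', j'⟩ hp' he
    simp at hp hp' he
    ext <;> simp <;> omega
  · rintro ⟨i, j⟩ hp
    simp at hp ⊢
    omega
  · intro i hi hi'
    rcases lt_or_ge (a + i) 0 with h' | h'
    · rw [mode_of_neg _ h', zero_mul]
    rcases lt_or_ge (b - i) 0 with h'' | h''
    · rw [mode_of_neg false h'', mul_zero]
    · exact absurd ⟨((a + i).toNat, (b - i).toNat), by simp; omega, by simp; omega⟩ hi'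
  · rintro ⟨i, j⟩ hp
    simp at hp
    have e1 : a + ((i : ℤ) - a) = i := by ring
    have e2 : b - ((i : ℤ) - a) = j := by omega
    simp only [e1, e2, mode_natCast]

/-- The delta function in the product of two vertex operators of opposite charge. -/
theorem exists_sum_normalProduct (c : L) (m n : ℤ) (f : Fock L) :
    ∃ B : ℕ, ∀ R : ℕ, B ≤ R →
      ∑ i ∈ Finset.Icc (-(R : ℤ)) R, normalProduct c true false (m + i) (n - i) f =
        if m + n = 0 then f else 0 := by
  -- Summing with `m + n` fixed puts both operators at the same point: the creation parts cancel,
  -- and `P` is evaluated on the diagonal of its two variables.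
  have key : ∀ P : Polynomial (Polynomial (Fock L)), ∃ B : ℕ, ∀ R : ℕ, B ≤ R →
      ∑ i ∈ Finset.Icc (-(R : ℤ)) R, extract₂ true false (m + i) (n - i) P =
        if m + n ≤ 0 then (Polynomial.eval Polynomial.X P).coeff (-(m + n)).toNat else 0 := by
    intro P
    induction P using Polynomial.induction_on' with
    | add p q hp hq =>
      obtain ⟨B, hB⟩ := hp
      obtain ⟨B', hB'⟩ := hq
      refine ⟨max B B', fun R hR => ?_⟩
      simp only [map_add, Finset.sum_add_distrib, Polynomial.eval_add, Polynomial.coeff_add]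
      rw [hB R (le_trans (le_max_left _ _) hR), hB' R (le_trans (le_max_right _ _) hR)]
      split_ifs <;> simp
    | monomial j p =>
      induction p using Polynomial.induction_on' with
      | add p q hp hq =>
        obtain ⟨B, hB⟩ := hp
        obtain ⟨B', hB'⟩ := hq
        refine ⟨max B B', fun R hR => ?_⟩
        simp only [map_add, Finset.sum_add_distrib, Polynomial.eval_add, Polynomial.coeff_add]
        rw [hB R (le_trans (le_max_left _ _) hR), hB' R (le_trans (le_max_right _ _) hR)]
        split_ifs <;> simp
      | monomial k x =>
        refine ⟨m.natAbs + n.natAbs + j + k, fun R hR => ?_⟩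
        have h := sum_mode_mul_mode (L := L) (m + k) (n + j) R (by omega) (by omega)
        have e : ∀ i : ℤ, extract₂ true false (m + i) (n - i)
            (Polynomial.monomial j (Polynomial.monomial k x)) =
            mode true (m + k + i) * mode false (n + j - i) * x := by
          intro i
          rw [extract₂_monomial, extract_monomial, ← mul_assoc, mul_comm (mode false _)]
          congr 3 <;> ring
        simp only [e]
        rw [← Finset.sum_mul, h, Polynomial.eval_monomial, Polynomial.monomial_mul_X_pow,
          Polynomial.coeff_monomial]
        split_ifs <;> first | omega | simp
  obtain ⟨B, hB⟩ := key (annihilation₂ c true false f)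
  refine ⟨B, fun R hR => ?_⟩
  simp only [normalProduct_eq]
  rw [hB R hR, eval_annihilation₂, Polynomial.coeff_C]
  split_ifs <;> first | rfl | omega

/-! ### Exchange relations of vertex operators -/

theorem eq_zero_of_forall_eq_succ {M : Type*} [Zero M] {f : ℤ → M} (h : ∀ l, f l = f (l + 1))
    {l₀ : ℤ} (h0 : f l₀ = 0) (l : ℤ) : f l = 0 := by
  have : ∀ l, f (l + l₀) = 0 := by
    intro l
    induction l with
    | zero => simpa using h0
    | succ i ih =>
      rw [← ih, h (i + l₀)]
      congr 1
      ring
    | pred i ih =>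
      rw [← ih, h (-i - 1 + l₀)]
      congr 1
      ring
  simpa using this (l - l₀)

/-- Solving the operator product relations of two vertex operators of opposite charge for one of
the two orderings. -/
theorem reorder_of_contraction {M : Type*} [AddCommGroup M] [Module L M] {t c : L} (htc : t * c = 1)
    {B X Y : ℤ → M} {R N : ℕ} (hB : ∀ i : ℤ, (R : ℤ) < i ∨ i < -R → B i = 0)
    (hX : ∀ i, X i - X (i + 1) = B i - c • B (i + 1))
    (hY : ∀ i, Y i - Y (i - 1) = B i - c • B (i - 1))
    (hX0 : ∀ i : ℤ, (N : ℤ) < i → X i = 0) {l₀ : ℤ} (hY0 : ∀ i, i < l₀ → Y i = 0) :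
    Y 0 = c • X 0 - (t - c) • ∑ l ∈ Finset.Icc 1 N, c ^ l • X (l : ℤ) +
      (1 - c) • ∑ i ∈ Finset.Icc (-(R : ℤ)) R, B i := by
  -- The tail sums solve both recursions: `X l = S (l - 1) - c S l` vanishes at `+∞`, and `Y l = (1
  -- - c) total - S l + c S (l - 1)` vanishes at `-∞`.
  set S : ℤ → M := fun l => ∑ i ∈ Finset.Icc (l + 1) (R : ℤ), B i with hS
  have S1 : ∀ l, S (l - 1) = B l + S l := by
    intro l
    simp only [hS, sub_add_cancel]
    rcases le_or_gt l R with h | h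
    · rw [← Finset.insert_Icc_add_one_left_eq_Icc h, Finset.sum_insert (by simp)]
    · rw [Finset.Icc_eq_empty (by omega), Finset.Icc_eq_empty (by omega), hB l (Or.inl h)]
      simp
  have S2 : ∀ l : ℤ, (R : ℤ) ≤ l → S l = 0 := by
    intro l h
    simp only [hS]
    rw [Finset.Icc_eq_empty (by omega), Finset.sum_empty]
  have S3 : ∀ l : ℤ, l < -R → S l = ∑ i ∈ Finset.Icc (-(R : ℤ)) R, B i := by
    intro l h
    symm
    refine Finset.sum_subset (Finset.Icc_subset_Icc_left (by omega)) fun i hi hi' => hB i ?_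
    simp at hi hi'
    omega
  generalize ∑ i ∈ Finset.Icc (-(R : ℤ)) R, B i = total at *
  have hX' : ∀ l, X l = S (l - 1) - c • S l := by
    intro l
    refine sub_eq_zero.mp (eq_zero_of_forall_eq_succ (f := fun l => X l - (S (l - 1) - c • S l))
      (l₀ := max N R + 1) (fun l => ?_) ?_ l)
    · have h1 := S1 l
      have h2 := S1 (l + 1)
      rw [add_sub_cancel_right] at h2
      rw [add_sub_cancel_right, ← sub_eq_zero]
      have h3 := hX l
      rw [h1, h2, sub_eq_iff_eq_add.mp h3]
      module
    · rw [hX0 _ (by omega), S2 _ (by omega), S2 _ (by omega)]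
      simp
  have hY' : ∀ l, Y l = (1 - c) • total - S l + c • S (l - 1) := by
    intro l
    refine sub_eq_zero.mp (eq_zero_of_forall_eq_succ
      (f := fun l => Y l - ((1 - c) • total - S l + c • S (l - 1)))
      (l₀ := min l₀ (-R) - 1) (fun l => ?_) ?_ l)
    · have h1 := S1 l
      have h2 := S1 (l + 1)
      rw [add_sub_cancel_right] at h2
      have h3 := hY (l + 1)
      rw [add_sub_cancel_right] at h3
      rw [add_sub_cancel_right, ← sub_eq_zero]
      rw [h1, h2, sub_eq_iff_eq_add.mp h3]
      module
    · rw [hY0 _ (by omega), S3 _ (by omega), S3 _ (by omega)]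
      module
  -- `N` may be smaller than `R`. For `i > N`, `X i = 0` reads `S (i - 1) = c S i`, so the vanishing
  -- of `S` descends from large indices to `N`.
  have hSN : S N = 0 := by
    have : ∀ k : ℕ, S (N + k) = 0 → S N = 0 := by
      intro k
      induction k with
      | zero => simp
      | succ k ih =>
        intro h
        apply ih
        have h1 := hX' (N + (k + 1 : ℕ))
        rw [h, hX0 _ (by omega), smul_zero, sub_zero] at h1
        rw [h1]
        congr 1
        push_cast
        ring
    exact this R (S2 _ (by omega))
  -- The weights `c ^ l` make the sum of the `S (l - 1) - c S l` telescope.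
  have htel : ∀ n : ℕ, ∑ l ∈ Finset.Icc 1 n, c ^ l • X (l : ℤ) = c • S 0 - c ^ (n + 1) • S n := by
    intro n
    induction n with
    | zero => simp
    | succ n ih =>
      rw [Finset.sum_Icc_succ_top (by omega), ih, hX']
      push_cast
      rw [add_sub_cancel_right, pow_succ c (n + 1)]
      module
  rw [htel, hSN, hY', hX', smul_zero, sub_zero, smul_smul, sub_mul, htc]
  module

/-- Reordering two vertex operators of opposite charge. -/
theorem vertex_false_true {t c : L} (htc : t * c = 1) (b n : ℤ) {N : ℕ} {f : Fock L}
    (hf : ∀ l : ℤ, (N : ℤ) < l → vertex c false (-n - l) f = 0) :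
    vertex c false (-n) (vertex c true b f) = c • vertex c true b (vertex c false (-n) f) -
      (t - c) • (∑ l ∈ Finset.Icc 1 N,
        c ^ l • vertex c true (b + (l : ℤ)) (vertex c false (-n - (l : ℤ)) f)) +
      if b = n then (1 - c) • f else 0 := by
  obtain ⟨B₁, hB₁⟩ := exists_normalProduct_eq_zero c true false f
  obtain ⟨B₂, hB₂⟩ := exists_normalProduct_eq_zero c false true f
  obtain ⟨B₃, hB₃⟩ := exists_sum_normalProduct c b (-n) f
  have h := reorder_of_contraction (N := N) (R := max B₃ (B₁ + B₂ + n.natAbs + b.natAbs)) htc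
    (B := fun i => normalProduct c true false (b + i) (-n - i) f)
    (X := fun i => vertex c true (b + i) (vertex c false (-n - i) f))
    (Y := fun i => vertex c false (-n - i) (vertex c true (b + i) f))
    (l₀ := -b - (annihilation c true f).natDegree) ?_ ?_ ?_ ?_ ?_
  · rw [hB₃ _ (le_max_left _ _)] at h
    have e : (if b = n then (1 - c) • f else 0) = (1 - c) • (if b + -n = 0 then f else 0) := by
      have : b = n ↔ b + -n = 0 := by omega
      simp only [this]
      split_ifs <;> simp
    rw [e]
    simpa using h
  · rintro i (hi | hi)
    · exact hB₁ _ _ (by omega)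
    · rw [normalProduct_comm]
      exact hB₂ _ _ (by omega)
  · intro i
    have := vertex_vertex c true false (b + i) (-n - i) f
    simpa [contrDen, contrNum, add_assoc, sub_sub] using this
  · intro i
    have := vertex_vertex c false true (-n - i) (b + i) f
    simp only [normalProduct_comm c false true] at this
    have e : -n - i + 1 = -n - (i - 1) := by ring
    simpa [contrDen, contrNum, e, add_sub_assoc] using this
  · intro i hi
    rw [hf i hi, map_zero]
  · intro i hi
    rw [vertex_eq_zero c true (by omega), map_zero]

/-- Reordering two vertex operators of equal charge. -/
theorem vertex_comm (c : L) (ε : Bool) (a : ℤ) (d : ℕ) (f : Fock L) :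
    vertex c ε a (vertex c ε (a + d) f) = vertex c ε (a + d) (vertex c ε a f) -
      (1 - c) • ∑ l ∈ Finset.Icc 1 d, vertex c ε (a + (l : ℤ)) (vertex c ε (a + d - (l : ℤ)) f) := by
  set Y : ℕ → Fock L := fun l => vertex c ε (a + (l : ℤ)) (vertex c ε (a + d - (l : ℤ)) f) with hY
  have h1 : ∀ j : ℕ, Y j - c • Y (j + 1) = normalProduct c ε ε (a + j) (a + d - j) f -
      normalProduct c ε ε (a + (j + 1 : ℕ)) (a + d - (j + 1 : ℕ)) f := by
    intro j
    have := vertex_vertex c ε ε (a + j) (a + d - j) f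
    simpa [hY, contrDen, contrNum, add_assoc, sub_sub] using this
  -- The sum telescopes to normal products with indices `(a, a + d)` and `(a + d, a)`, which agree
  -- by symmetry.
  have h2 : ∑ j ∈ Finset.range d, (Y j - c • Y (j + 1)) = 0 := by
    rw [Finset.sum_congr rfl fun j _ => h1 j, Finset.sum_range_sub' (fun j : ℕ =>
      normalProduct c ε ε (a + j) (a + d - j) f), normalProduct_comm]
    simp
  have h3 : ∑ l ∈ Finset.Icc 1 d, Y l = ∑ j ∈ Finset.range d, Y (j + 1) := by
    rw [Finset.range_eq_Ico, Finset.sum_Ico_add' Y 0 d 1]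
    rfl
  have h4 : ∑ j ∈ Finset.range d, Y (j + 1) + Y 0 = ∑ j ∈ Finset.range d, Y j + Y d := by
    rw [← Finset.sum_range_succ, ← Finset.sum_range_succ']
  rw [Finset.sum_sub_distrib, ← Finset.smul_sum] at h2
  have h5 : Y 0 = vertex c ε a (vertex c ε (a + d) f) := by simp [hY]
  have h6 : Y d = vertex c ε (a + d) (vertex c ε a f) := by simp [hY]
  rw [← h5, ← h6, h3]
  rw [sub_eq_zero] at h2
  rw [eq_sub_of_add_eq' h4, h2]
  module

/-! ### The grading of the Fock space -/

variable (L) in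
/-- The subspace of the Fock space of energy `d`. -/
def grade (d : ℤ) : Submodule L (Fock L) :=
  MvPolynomial.weightedHomogeneousSubmodule L (fun i : ℕ => (i : ℤ) + 1) d

instance : SetLike.GradedMonoid (grade L) :=
  MvPolynomial.WeightedHomogeneousSubmodule.gradedMonoid

theorem one_mem_grade : (1 : Fock L) ∈ grade L 0 := MvPolynomial.isWeightedHomogeneous_one L _

theorem grade_weight_nonneg (s : ℕ →₀ ℕ) : 0 ≤ Finsupp.weight (fun i : ℕ => (i : ℤ) + 1) s := by
  rw [Finsupp.weight_apply]
  exact Finset.sum_nonneg fun i _ => by positivity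

theorem eq_zero_of_mem_grade {d : ℤ} (hd : d < 0) {f : Fock L} (hf : f ∈ grade L d) : f = 0 := by
  ext s
  rw [MvPolynomial.coeff_zero]
  refine MvPolynomial.IsWeightedHomogeneous.coeff_eq_zero hf s ?_
  have := grade_weight_nonneg s
  omega

theorem constantCoeff_of_mem_grade {d : ℤ} (hd : d ≠ 0) {f : Fock L} (hf : f ∈ grade L d) :
    MvPolynomial.constantCoeff f = 0 := by
  rw [MvPolynomial.constantCoeff_eq]
  exact MvPolynomial.IsWeightedHomogeneous.coeff_eq_zero hf 0 (by simpa using hd.symm)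

theorem eq_C_of_mem_grade_zero {f : Fock L} (hf : f ∈ grade L 0) :
    f = MvPolynomial.C (MvPolynomial.constantCoeff f) := by
  ext s
  rw [MvPolynomial.coeff_C, MvPolynomial.constantCoeff_eq]
  split_ifs with h
  · rw [h]
  · refine MvPolynomial.IsWeightedHomogeneous.coeff_eq_zero hf s fun h0 => h ?_
    rw [Finsupp.weight_apply, Finsupp.sum,
      Finset.sum_eq_zero_iff_of_nonneg fun i _ => by positivity] at h0
    ext i
    by_contra hi
    have := h0 i (by simpa using fun h => hi (by simp [h]))
    rw [smul_eq_zero] at this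
    rcases this with h1 | h1
    · exact hi (by simp [h1])
    · omega

theorem mode_mem_grade (ε : Bool) (n : ℤ) : (mode ε n : Fock L) ∈ grade L n := by
  rcases lt_or_ge n 0 with h | h
  · rw [mode_of_neg _ h]
    exact Submodule.zero_mem _
  obtain ⟨n, rfl⟩ := Int.eq_ofNat_of_zero_le h
  have h1 : ∀ n : ℕ, PowerSeries.coeff n (creation L true) ∈ grade L n := by
    intro n
    rw [creation, PowerSeries.coeff_mk]
    cases n with
    | zero => simpa using one_mem_grade (L := L)
    | succ n => exact_mod_cast MvPolynomial.isWeightedHomogeneous_X L (fun i : ℕ => (i : ℤ) + 1) n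
  rw [mode_natCast]
  cases ε
  · induction n using Nat.strong_induction_on with
    | _ n ih =>
      have h2 : PowerSeries.coeff n (creation L false) = if n = 0 then 1 else
          -∑ p ∈ Finset.HasAntidiagonal.antidiagonal n, if p.2 < n then
            PowerSeries.coeff p.1 (creation L true) * PowerSeries.coeff p.2 (creation L false)
          else 0 := by
        conv_lhs => rw [creation, PowerSeries.coeff_invOfUnit]
        simp [creation]
      rw [h2]
      split_ifs with hn
      · rw [hn, Nat.cast_zero]
        exact one_mem_grade
      · refine Submodule.neg_mem _ (Submodule.sum_mem _ fun p hp => ?_)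
        rw [Finset.HasAntidiagonal.mem_antidiagonal] at hp
        split_ifs with hp2
        · rw [← hp, Nat.cast_add]
          exact SetLike.mul_mem_graded (h1 _) (ih _ hp2 (by omega))
        · exact Submodule.zero_mem _
  · exact h1 n

variable (L) in
/-- The polynomials in `u` over the Fock space that are homogeneous of degree `d`, where `u` has
degree one. -/
def polyGrade (d : ℤ) : Submodule L (Polynomial (Fock L)) where
  carrier := {P | ∀ j : ℕ, P.coeff j ∈ grade L (d - j)}
  zero_mem' j := by simp
  add_mem' hp hq j := by
    rw [Polynomial.coeff_add]
    exact Submodule.add_mem _ (hp j) (hq j)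
  smul_mem' a p hp j := by
    rw [Polynomial.coeff_smul]
    exact Submodule.smul_mem _ _ (hp j)

instance : SetLike.GradedMonoid (polyGrade L) where
  one_mem j := by
    rw [Polynomial.coeff_one]
    split_ifs with h
    · rw [h, Nat.cast_zero, sub_zero]
      exact one_mem_grade
    · exact Submodule.zero_mem _
  mul_mem d e P P' hP hP' j := by
    rw [Polynomial.coeff_mul]
    refine Submodule.sum_mem _ fun p hp => ?_
    rw [Finset.HasAntidiagonal.mem_antidiagonal] at hp
    have h : d + e - (j : ℤ) = (d - p.1) + (e - p.2) := by omega
    rw [h]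
    exact SetLike.mul_mem_graded (hP _) (hP' _)

theorem annihilation_X_mem (c : L) (ε : Bool) (i : ℕ) :
    annihilation c ε (MvPolynomial.X i) ∈ polyGrade L ((i : ℤ) + 1) := by
  rw [annihilation, MvPolynomial.aeval_X, PowerSeries.coeff_mul]
  refine Submodule.sum_mem _ fun p hp => ?_
  rw [Finset.HasAntidiagonal.mem_antidiagonal] at hp
  rw [coeff_twist, PowerSeries.coeff_map]
  have h : (i : ℤ) + 1 = p.1 + 0 + p.2 := by omega
  rw [h]
  refine SetLike.mul_mem_graded (SetLike.mul_mem_graded ?_ ?_) ?_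
  · intro j
    rw [Polynomial.coeff_X_pow]
    split_ifs with hj
    · rw [hj, sub_self]
      exact one_mem_grade
    · exact Submodule.zero_mem _
  · intro j
    rw [Polynomial.coeff_C]
    split_ifs with hj
    · rw [hj]
      exact MvPolynomial.isWeightedHomogeneous_C _ _
    · exact Submodule.zero_mem _
  · intro j
    rw [Polynomial.coeff_C]
    split_ifs with hj
    · rw [hj, ← mode_natCast, Nat.cast_zero, sub_zero]
      exact mode_mem_grade _ _
    · exact Submodule.zero_mem _

theorem annihilation_mem (c : L) (ε : Bool) {d : ℤ} {f : Fock L} (hf : f ∈ grade L d) :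
    annihilation c ε f ∈ polyGrade L d := by
  induction hf using MvPolynomial.IsWeightedHomogeneous.induction_on with
  | zero => simp
  | add p q hp hq h1 h2 =>
    rw [map_add]
    exact Submodule.add_mem _ h1 h2
  | monomial s r hr =>
    have h1 : MvPolynomial.monomial s r =
        r • ∏ i ∈ s.support, (MvPolynomial.X i : Fock L) ^ s i := by
      rw [MvPolynomial.monomial_eq, MvPolynomial.smul_eq_C_mul, Finsupp.prod]
    rw [h1, map_smul, map_prod, ← hr, Finsupp.weight_apply]
    simp only [map_pow]
    exact Submodule.smul_mem _ _ (SetLike.prod_pow_mem_graded (polyGrade L) _ _ _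
      fun i _ => annihilation_X_mem c ε i)

theorem vertex_mem (c : L) (ε : Bool) {n d : ℤ} {f : Fock L} (hf : f ∈ grade L d) :
    vertex c ε n f ∈ grade L (n + d) := by
  rw [vertex_apply, extract, Polynomial.lsum_apply]
  refine Submodule.sum_mem _ fun j _ => ?_
  have h : n + d = (n + j) + (d - j) := by ring
  rw [h]
  exact SetLike.mul_mem_graded (mode_mem_grade ε _) (annihilation_mem c ε hf j)

theorem vertex_one (c : L) (ε : Bool) : vertex c ε 0 1 = 1 := by
  rw [vertex_apply, map_one, ← Polynomial.monomial_zero_one, extract_monomial]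
  have := mode_natCast (L := L) ε 0
  rw [coeff_zero_creation] at this
  simpa using this

/-! ### The bosonization of the crystallized deformed Virasoro algebra -/

/-- The operators `T_n` on the Fock space. -/
def bosonT (c k : L) (n : ℤ) : Module.End L (Fock L) :=
  (if n ≤ 0 then k • vertex c true (-n) else 0) + if 0 ≤ n then k⁻¹ • vertex c false (-n) else 0

theorem bosonT_pos (c k : L) {n : ℤ} (hn : 0 < n) (f : Fock L) :
    bosonT c k n f = k⁻¹ • vertex c false (-n) f := by
  simp [bosonT, hn.le, hn.not_ge]

theorem bosonT_neg (c k : L) {n : ℤ} (hn : n < 0) (f : Fock L) :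
    bosonT c k n f = k • vertex c true (-n) f := by
  simp [bosonT, hn.le, hn.not_ge]

theorem bosonT_zero (c k : L) (f : Fock L) :
    bosonT c k 0 f = k • vertex c true 0 f + k⁻¹ • vertex c false 0 f := by
  simp [bosonT]

theorem bosonT_mem (c k : L) {n d : ℤ} {f : Fock L} (hf : f ∈ grade L d) :
    bosonT c k n f ∈ grade L (d - n) := by
  have h : ∀ ε, vertex c ε (-n) f ∈ grade L (d - n) := by
    intro ε
    rw [sub_eq_neg_add]
    exact vertex_mem c ε hf
  rw [bosonT, LinearMap.add_apply]
  refine Submodule.add_mem _ ?_ ?_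
  · split_ifs
    · exact Submodule.smul_mem _ _ (h _)
    · exact Submodule.zero_mem _
  · split_ifs
    · exact Submodule.smul_mem _ _ (h _)
    · exact Submodule.zero_mem _

theorem bosonT_comm_of_pos (c k : L) {n m : ℤ} (hm : 0 < m) (hnm : m < n) (f : Fock L) :
    bosonT c k n (bosonT c k m f) = bosonT c k m (bosonT c k n f) -
      (1 - c) • ∑ l ∈ Finset.Icc 1 (n - m).toNat,
        bosonT c k (n - (l : ℤ)) (bosonT c k (m + (l : ℤ)) f) := by
  have h := vertex_comm c false (-n) (n - m).toNat f
  have e : -n + ((n - m).toNat : ℤ) = -m := by omega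
  rw [e] at h
  have h1 : ∑ l ∈ Finset.Icc 1 (n - m).toNat,
      bosonT c k (n - (l : ℤ)) (bosonT c k (m + (l : ℤ)) f) =
      (k⁻¹ * k⁻¹) • ∑ l ∈ Finset.Icc 1 (n - m).toNat,
        vertex c false (-n + (l : ℤ)) (vertex c false (-m - (l : ℤ)) f) := by
    rw [Finset.smul_sum]
    refine Finset.sum_congr rfl fun l hl => ?_
    rw [Finset.mem_Icc] at hl
    rw [bosonT_pos _ _ (by omega), bosonT_pos _ _ (by omega), map_smul, smul_smul, neg_sub,
      neg_add', sub_eq_neg_add (l : ℤ) n]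
  rw [h1, bosonT_pos _ _ (by omega), bosonT_pos _ _ (by omega), bosonT_pos _ _ (by omega),
    bosonT_pos _ _ (by omega), map_smul, map_smul, h]
  module

theorem bosonT_comm_of_neg (c k : L) {n m : ℤ} (hn : n < 0) (hnm : m < n) (f : Fock L) :
    bosonT c k n (bosonT c k m f) = bosonT c k m (bosonT c k n f) -
      (1 - c) • ∑ l ∈ Finset.Icc 1 (n - m).toNat,
        bosonT c k (n - (l : ℤ)) (bosonT c k (m + (l : ℤ)) f) := by
  have h := vertex_comm c true (-n) (n - m).toNat f
  have e : -n + ((n - m).toNat : ℤ) = -m := by omega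
  rw [e] at h
  have h1 : ∑ l ∈ Finset.Icc 1 (n - m).toNat,
      bosonT c k (n - (l : ℤ)) (bosonT c k (m + (l : ℤ)) f) =
      (k * k) • ∑ l ∈ Finset.Icc 1 (n - m).toNat,
        vertex c true (-n + (l : ℤ)) (vertex c true (-m - (l : ℤ)) f) := by
    rw [Finset.smul_sum]
    refine Finset.sum_congr rfl fun l hl => ?_
    rw [Finset.mem_Icc] at hl
    rw [bosonT_neg _ _ (by omega), bosonT_neg _ _ (by omega), map_smul, smul_smul, neg_sub,
      neg_add', sub_eq_neg_add (l : ℤ) n]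
  rw [h1, bosonT_neg _ _ (by omega), bosonT_neg _ _ (by omega), bosonT_neg _ _ (by omega),
    bosonT_neg _ _ (by omega), map_smul, map_smul, h]
  module

/-- `T_0` contains both charges: the equal-charge exchange gives the finite sum, the opposite-charge
one the tail. The summand `l = n` is `T_0 T_n`; it completes the former and turns the coefficient
`1` of the opposite-charge product into `c`. -/
theorem bosonT_comm_pos_zero {t c k : L} (htc : t * c = 1) (hk : k ≠ 0) {n : ℤ} (hn : 0 < n) {N : ℕ}
    {f : Fock L} (hf : ∀ l : ℤ, (N : ℤ) < l → vertex c false (-n - l) f = 0) :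
    bosonT c k n (bosonT c k 0 f) = bosonT c k 0 (bosonT c k n f) -
      (1 - c) • (∑ l ∈ Finset.Icc 1 n.toNat, bosonT c k (n - (l : ℤ)) (bosonT c k (l : ℤ) f)) -
      (t - c) • ∑ l ∈ Finset.Icc 1 N, c ^ l • bosonT c k (-(l : ℤ)) (bosonT c k (n + (l : ℤ)) f) := by
  obtain ⟨p, rfl⟩ : ∃ p : ℕ, n = (p + 1 : ℕ) := ⟨(n - 1).toNat, by omega⟩
  have h := vertex_comm c false (-(p + 1 : ℕ)) (p + 1) f
  have h' := vertex_false_true htc 0 (p + 1 : ℕ) hf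
  rw [neg_add_cancel, Finset.sum_Icc_succ_top (by omega)] at h
  rw [if_neg (by omega)] at h'
  have h1 : ∑ l ∈ Finset.Icc 1 p, bosonT c k ((p + 1 : ℕ) - (l : ℤ)) (bosonT c k (l : ℤ) f) =
      (k⁻¹ * k⁻¹) • ∑ l ∈ Finset.Icc 1 p,
        vertex c false (-(p + 1 : ℕ) + (l : ℤ)) (vertex c false (0 - (l : ℤ)) f) := by
    rw [Finset.smul_sum]
    refine Finset.sum_congr rfl fun l hl => ?_
    rw [Finset.mem_Icc] at hl
    rw [bosonT_pos _ _ (by omega), bosonT_pos _ _ (by omega), map_smul, smul_smul, neg_sub,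
      zero_sub, sub_eq_neg_add]
  have h2 : ∑ l ∈ Finset.Icc 1 N,
      c ^ l • bosonT c k (-(l : ℤ)) (bosonT c k ((p + 1 : ℕ) + (l : ℤ)) f) =
      ∑ l ∈ Finset.Icc 1 N, c ^ l •
        vertex c true (0 + (l : ℤ)) (vertex c false (-(p + 1 : ℕ) - (l : ℤ)) f) := by
    refine Finset.sum_congr rfl fun l hl => ?_
    rw [Finset.mem_Icc] at hl
    rw [bosonT_neg _ _ (by omega), bosonT_pos _ _ (by omega), map_smul, smul_inv_smul₀ hk,
      neg_neg, zero_add, neg_add']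
  rw [Int.toNat_natCast, Finset.sum_Icc_succ_top (by omega), h1, h2, sub_self]
  rw [bosonT_zero, bosonT_zero, bosonT_pos _ _ hn, bosonT_pos _ _ hn]
  simp only [map_add, map_smul, smul_add, smul_smul, inv_mul_cancel₀ hk, mul_inv_cancel₀ hk]
  rw [h, h', neg_add_cancel, zero_sub]
  module

theorem bosonT_comm_zero_neg {t c k : L} (htc : t * c = 1) (hk : k ≠ 0) {m : ℤ} (hm : m < 0) {N : ℕ}
    {f : Fock L} (hf : ∀ l : ℤ, (N : ℤ) < l → vertex c false (-l) f = 0) :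
    bosonT c k 0 (bosonT c k m f) = bosonT c k m (bosonT c k 0 f) -
      (1 - c) • (∑ l ∈ Finset.Icc 1 (-m).toNat,
        bosonT c k (-(l : ℤ)) (bosonT c k (m + (l : ℤ)) f)) -
      (t - c) • ∑ l ∈ Finset.Icc 1 N, c ^ l • bosonT c k (m - (l : ℤ)) (bosonT c k (l : ℤ) f) := by
  obtain ⟨p, rfl⟩ : ∃ p : ℕ, m = -(p + 1 : ℕ) := ⟨(-m - 1).toNat, by omega⟩
  have h := vertex_comm c true 0 (p + 1) f
  have h' := vertex_false_true htc (p + 1 : ℕ) 0 (N := N) (f := f)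
    (fun l hl => by rw [neg_zero, zero_sub]; exact hf l hl)
  rw [zero_add, Finset.sum_Icc_succ_top (by omega)] at h
  rw [if_neg (by omega), neg_zero] at h'
  have h1 : ∑ l ∈ Finset.Icc 1 p, bosonT c k (-(l : ℤ)) (bosonT c k (-(p + 1 : ℕ) + (l : ℤ)) f) =
      (k * k) • ∑ l ∈ Finset.Icc 1 p,
        vertex c true (0 + (l : ℤ)) (vertex c true ((p + 1 : ℕ) - (l : ℤ)) f) := by
    rw [Finset.smul_sum]
    refine Finset.sum_congr rfl fun l hl => ?_
    rw [Finset.mem_Icc] at hl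
    rw [bosonT_neg _ _ (by omega), bosonT_neg _ _ (by omega), map_smul, smul_smul, neg_neg,
      zero_add, neg_add', neg_neg]
  have h2 : ∑ l ∈ Finset.Icc 1 N,
      c ^ l • bosonT c k (-(p + 1 : ℕ) - (l : ℤ)) (bosonT c k (l : ℤ) f) =
      ∑ l ∈ Finset.Icc 1 N, c ^ l •
        vertex c true ((p + 1 : ℕ) + (l : ℤ)) (vertex c false (0 - (l : ℤ)) f) := by
    refine Finset.sum_congr rfl fun l hl => ?_
    rw [Finset.mem_Icc] at hl
    rw [bosonT_neg _ _ (by omega), bosonT_pos _ _ (by omega), map_smul, smul_inv_smul₀ hk,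
      neg_sub', neg_neg, zero_sub, sub_neg_eq_add]
  rw [neg_neg, Int.toNat_natCast, Finset.sum_Icc_succ_top (by omega), h1, h2, neg_add_cancel]
  rw [bosonT_zero, bosonT_zero, bosonT_neg _ _ hm, bosonT_neg _ _ hm]
  simp only [map_add, map_smul, smul_add, smul_smul, inv_mul_cancel₀ hk, mul_inv_cancel₀ hk, neg_neg]
  rw [h, h', sub_self, zero_add]
  module

theorem bosonT_comm_pos_neg {t c k : L} (htc : t * c = 1) (hk : k ≠ 0) {n m : ℤ} (hn : 0 < n)
    (hm : m < 0) {N : ℕ} {f : Fock L}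
    (hf : ∀ l : ℤ, (N : ℤ) < l → vertex c false (-n - l) f = 0) :
    bosonT c k n (bosonT c k m f) = c • bosonT c k m (bosonT c k n f) -
      (t - c) • (∑ l ∈ Finset.Icc 1 N,
        c ^ l • bosonT c k (m - (l : ℤ)) (bosonT c k (n + (l : ℤ)) f)) +
      if n + m = 0 then (1 - c) • f else 0 := by
  have h' := vertex_false_true htc (-m) n hf
  have h2 : ∑ l ∈ Finset.Icc 1 N,
      c ^ l • bosonT c k (m - (l : ℤ)) (bosonT c k (n + (l : ℤ)) f) =
      ∑ l ∈ Finset.Icc 1 N, c ^ l •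
        vertex c true (-m + (l : ℤ)) (vertex c false (-n - (l : ℤ)) f) := by
    refine Finset.sum_congr rfl fun l hl => ?_
    rw [bosonT_neg _ _ (by omega), bosonT_pos _ _ (by omega), map_smul, smul_inv_smul₀ hk,
      neg_sub', sub_neg_eq_add, neg_add']
  have e : -m = n ↔ n + m = 0 := by omega
  rw [h2, bosonT_neg _ _ hm, bosonT_pos _ _ hn, bosonT_neg _ _ hm, bosonT_pos _ _ hn]
  simp only [map_smul, smul_smul, inv_mul_cancel₀ hk, mul_inv_cancel₀ hk, one_smul]
  rw [h']
  simp only [e]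

variable {K : Type*} [Field K] [Algebra K L]

/-- The Fock space as a representation of the free algebra. -/
def bosonization (t : K) (k : L) : Free K →ₐ[K] Module.End K (Fock L) :=
  FreeAlgebra.lift K fun n => (bosonT (algebraMap K L t⁻¹) k n).restrictScalars K

theorem bosonization_T (t : K) (k : L) (n : ℤ) (f : Fock L) :
    bosonization t k (T n) f = bosonT (algebraMap K L t⁻¹) k n f := by
  simp [bosonization, T]

theorem bosonization_word_mem (t : K) (k : L) (w : List ℤ) {d : ℤ} {f : Fock L}
    (hf : f ∈ grade L d) : bosonization t k (word w) f ∈ grade L (d - w.sum) := by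
  induction w with
  | nil => simpa [word_nil] using hf
  | cons n w ih =>
    rw [map_word_cons, bosonization_T, List.sum_cons]
    have h : d - (n + w.sum) = d - w.sum - n := by ring
    rw [h]
    exact bosonT_mem _ _ ih

theorem bosonization_relator {t : K} (ht0 : t ≠ 0) {k : L} (hk : k ≠ 0) {n m d : ℤ} {N : ℕ}
    (hnm : m < n) (hN : d ≤ n + (N : ℤ)) {f : Fock L} (hf : f ∈ grade L d) :
    bosonization t k (relator t n m N) f = 0 := by
  have htc : algebraMap K L t * algebraMap K L t⁻¹ = 1 := by
    rw [← map_mul, mul_inv_cancel₀ ht0, map_one]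
  have hsm : ∀ (a : K) (x : Fock L), a • x = algebraMap K L a • x := fun a x =>
    (algebraMap_smul L a x).symm
  -- Beyond the cut-off the energy `d - n - l` would be negative.
  have hv : ∀ l : ℤ, (N : ℤ) < l → vertex (algebraMap K L t⁻¹) false (-n - l) f = 0 := by
    intro l hl
    exact eq_zero_of_mem_grade (by omega) (vertex_mem _ _ hf)
  rw [relator, map_sub, map_sub, map_mul, map_mul]
  simp only [LinearMap.sub_apply, Module.End.mul_apply, bosonization_T]
  by_cases h1 : 0 < m ∨ n < 0
  · have h : bosonT (algebraMap K L t⁻¹) k n (bosonT (algebraMap K L t⁻¹) k m f) = _ :=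
      h1.elim (fun h => bosonT_comm_of_pos _ k h hnm f) fun h => bosonT_comm_of_neg _ k h hnm f
    rw [h, bracket, if_pos h1]
    simp only [map_neg, map_smul, map_sum, map_mul, LinearMap.neg_apply, LinearMap.smul_apply,
      LinearMap.sum_apply, Module.End.mul_apply, bosonization_T, hsm (1 - t⁻¹), map_sub, map_one]
    module
  by_cases h2 : m = 0
  · subst h2
    rw [bosonT_comm_pos_zero htc hk hnm hv, bracket, if_neg h1, if_pos rfl]
    simp only [tail, map_neg, map_smul, map_sum, map_mul, LinearMap.neg_apply,
      LinearMap.smul_apply, LinearMap.sub_apply, zero_sub,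
      LinearMap.sum_apply, Module.End.mul_apply, bosonization_T, hsm, map_sub, map_one, map_pow]
    module
  by_cases h3 : n = 0
  · subst h3
    rw [bosonT_comm_zero_neg htc hk hnm (by simpa using hv), bracket, if_neg h1, if_neg h2,
      if_pos rfl]
    simp only [tail, map_neg, map_smul, map_sum, map_mul, LinearMap.neg_apply,
      LinearMap.smul_apply, LinearMap.sub_apply, zero_add,
      LinearMap.sum_apply, Module.End.mul_apply, bosonization_T, hsm, map_sub, map_one, map_pow]
    module
  rw [bosonT_comm_pos_neg htc hk (by omega) (by omega) hv, bracket, if_neg h1, if_neg h2,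
    if_neg h3]
  split_ifs
  · simp only [tail, map_neg, map_smul, map_sum, map_mul, LinearMap.neg_apply, map_add,
      LinearMap.smul_apply, LinearMap.sub_apply, LinearMap.add_apply, AlgHom.commutes,
      Module.algebraMap_end_apply,
      LinearMap.sum_apply, Module.End.mul_apply, bosonization_T, hsm, map_sub, map_one, map_pow]
    module
  · simp only [tail, map_neg, map_smul, map_sum, map_mul, LinearMap.neg_apply, map_add,
      LinearMap.smul_apply, LinearMap.sub_apply, LinearMap.add_apply, map_zero,
      LinearMap.zero_apply,
      LinearMap.sum_apply, Module.End.mul_apply, bosonization_T, hsm, map_sub, map_one, map_pow]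
    module

end Fock

section

variable {K : Type*} [Field K]

/-! ### The vacuum expectation value -/

theorem isHighestWeight_bosonization {L : Type*} [Field L] [Algebra K L] {t h : K} (ht0 : t ≠ 0)
    {k : L} (hk : k ≠ 0) (hkh : k + k⁻¹ = algebraMap K L h) :
    IsHighestWeight t h (bosonization t k) (1 : Fock L) where
  word_eq_zero w hw :=
    eq_zero_of_mem_grade (by omega) (bosonization_word_mem t k w one_mem_grade)
  weight := by
    rw [bosonization_T, bosonT_zero, vertex_one, vertex_one, ← add_smul, hkh, algebraMap_smul]
  relator_eq_zero n m N w hnm hN :=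
    bosonization_relator ht0 hk hnm (by omega) (bosonization_word_mem t k w one_mem_grade)

theorem IsHighestWeight.apply_leftRelation {V : Type*} [AddCommGroup V] [Module K V] {t h : K}
    {ρ : Free K →ₐ[K] Module.End K V} {v₀ : V} (H : IsHighestWeight t h ρ v₀) {r : Free K}
    (hr : r ∈ leftRelations t h) : ρ r v₀ = 0 := by
  rcases hr with (⟨w, hw, rfl⟩ | hr) | ⟨n, m, N, w, hnm, hN, rfl⟩
  · exact H.word_eq_zero w hw
  · rw [Set.mem_singleton_iff] at hr
    rw [hr, map_sub, LinearMap.sub_apply, H.weight, AlgHom.commutes, Module.algebraMap_end_apply,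
      sub_self]
  · rw [map_mul, Module.End.mul_apply]
    exact H.relator_eq_zero n m N w hnm hN

/-- Relators are homogeneous for every cut-off; in nonzero total degree this alone makes the vacuum
coefficient vanish. -/
theorem bosonization_relator_mem {L : Type*} [Field L] [Algebra K L] (t : K) (k : L) (n m : ℤ)
    (N : ℕ) {d : ℤ} {f : Fock L} (hf : f ∈ grade L d) :
    bosonization t k (relator t n m N) f ∈ grade L (d - (n + m)) := by
  let S : Submodule K (Free K) := ((grade L (d - (n + m))).restrictScalars K).comap
    (LinearMap.applyₗ f ∘ₗ (bosonization t k).toLinearMap)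
  have hT : ∀ a b : ℤ, a + b = n + m → T a * T b ∈ S := by
    intro a b hab
    have h : bosonization t k (T a * T b) f ∈ grade L (d - (n + m)) := by
      rw [map_mul, Module.End.mul_apply, bosonization_T, bosonization_T, ← hab, ← sub_sub,
        sub_right_comm]
      exact bosonT_mem _ _ (bosonT_mem _ _ hf)
    exact h
  have htail : ∀ a b : ℤ, a + b = n + m → tail t a b N ∈ S := fun a b hab =>
    Submodule.sum_mem _ fun l _ => Submodule.smul_mem _ _ (hT _ _ (by omega))
  suffices h : relator t n m N ∈ S from h
  rw [relator, bracket]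
  refine Submodule.sub_mem _ (Submodule.sub_mem _ (hT _ _ rfl) (hT _ _ (add_comm _ _))) ?_
  split_ifs with h1 h2 h3 h4
  · exact Submodule.neg_mem _ (Submodule.smul_mem _ _ (Submodule.sum_mem _ fun l _ =>
      hT _ _ (by omega)))
  · refine Submodule.sub_mem _ (Submodule.neg_mem _ (Submodule.smul_mem _ _
      (Submodule.sum_mem _ fun l _ => hT _ _ (by omega))))
      (Submodule.smul_mem _ _ (htail _ _ (by omega)))
  · refine Submodule.sub_mem _ (Submodule.neg_mem _ (Submodule.smul_mem _ _
      (Submodule.sum_mem _ fun l _ => hT _ _ (by omega))))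
      (Submodule.smul_mem _ _ (htail _ _ (by omega)))
  · refine Submodule.add_mem _ (Submodule.sub_mem _ (Submodule.neg_mem _ (Submodule.smul_mem _ _
      (hT _ _ (by omega)))) (Submodule.smul_mem _ _ (htail _ _ rfl))) ?_
    have h : bosonization t k (algebraMap K (Free K) (1 - t⁻¹)) f ∈ grade L (d - (n + m)) := by
      rw [AlgHom.commutes, Module.algebraMap_end_apply, h4, sub_zero, ← algebraMap_smul L]
      exact Submodule.smul_mem _ _ hf
    exact h
  · exact Submodule.add_mem _ (Submodule.sub_mem _ (Submodule.neg_mem _ (Submodule.smul_mem _ _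
      (hT _ _ (by omega)))) (Submodule.smul_mem _ _ (htail _ _ rfl))) (Submodule.zero_mem _)

/-- In the bosonization `T_0` has weight `k + k⁻¹`, so a prescribed `h` needs a root of `k² - h k +
1`; this is the reason for passing to the algebraic closure. -/
theorem exists_add_inv_eq {L : Type*} [Field L] [IsAlgClosed L] (h : L) :
    ∃ k : L, k ≠ 0 ∧ k + k⁻¹ = h := by
  obtain ⟨k, hk⟩ := IsAlgClosed.exists_root
    (Polynomial.X ^ 2 - Polynomial.C h * Polynomial.X + 1 : Polynomial L) (by
      have : (Polynomial.X ^ 2 - Polynomial.C h * Polynomial.X + 1 : Polynomial L).degree = 2 := by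
        compute_degree!
      rw [this]
      decide)
  simp only [Polynomial.IsRoot.def, Polynomial.eval_add, Polynomial.eval_sub, Polynomial.eval_pow,
    Polynomial.eval_X, Polynomial.eval_mul, Polynomial.eval_C, Polynomial.eval_one] at hk
  have hk0 : k ≠ 0 := by
    rintro rfl
    simp at hk
  refine ⟨k, hk0, ?_⟩
  field_simp
  linear_combination hk

/-- Linear functionals on the free algebra are determined by their values on words. -/
theorem linearMap_ext_word {V : Type*} [AddCommGroup V] [Module K V] {f g : Free K →ₗ[K] V}
    (h : ∀ w, f (word w) = g (word w)) : f = g :=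
  LinearMap.ext_on span_word (by rintro _ ⟨w, rfl⟩; exact h w)

/-- The vacuum expectation value on the free algebra. -/
theorem exists_vacuumExpectation {t : K} (h : K) (ht0 : t ≠ 0) :
    ∃ φ : Free K →ₗ[K] K, φ 1 = 1 ∧ (∀ r ∈ leftRelations t h, ∀ x, φ (x * r) = 0) ∧
      ∀ r ∈ rightRelations t h, ∀ x, φ (r * x) = 0 := by
  obtain ⟨k, hk, hkh⟩ := exists_add_inv_eq (algebraMap K (AlgebraicClosure K) h)
  have H := isHighestWeight_bosonization ht0 hk hkh
  -- A `K`-linear retraction brings the vacuum coefficient back from the closure to `K`;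
  -- multiplicativity is not needed.
  obtain ⟨g, hg⟩ := LinearMap.exists_leftInverse_of_injective
    (Algebra.linearMap K (AlgebraicClosure K))
    (LinearMap.ker_eq_bot.mpr (algebraMap K (AlgebraicClosure K)).injective)
  let φ : Free K →ₗ[K] K := g ∘ₗ
    (MvPolynomial.lcoeff (AlgebraicClosure K) (0 : ℕ →₀ ℕ)).restrictScalars K ∘ₗ
    LinearMap.applyₗ (1 : Fock (AlgebraicClosure K)) ∘ₗ (bosonization t k).toLinearMap
  have hφ : ∀ x, φ x = g (MvPolynomial.constantCoeff (bosonization t k x 1)) := fun x => rfl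
  have hg1 : g 1 = 1 := by
    have := LinearMap.congr_fun hg (1 : K)
    simpa using this
  have hdeg : ∀ {d : ℤ} {x : Free K}, d ≠ 0 → bosonization t k x 1 ∈ grade (AlgebraicClosure K) d →
      φ x = 0 := by
    intro d x hd hx
    rw [hφ, constantCoeff_of_mem_grade hd hx, map_zero]
  have hw : ∀ w : List ℤ, bosonization t k (word w) 1 ∈ grade (AlgebraicClosure K) (-w.sum) := by
    intro w
    simpa using bosonization_word_mem t k w (one_mem_grade (L := AlgebraicClosure K))
  refine ⟨φ, ?_, ?_, ?_⟩
  · rw [hφ, map_one (bosonization t k), Module.End.one_apply, map_one MvPolynomial.constantCoeff,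
      hg1]
  · intro r hr x
    rw [hφ, map_mul, Module.End.mul_apply, H.apply_leftRelation hr, map_zero, map_zero, map_zero]
  · intro r hr x
    suffices hs : φ ∘ₗ LinearMap.mulLeft K r = 0 from LinearMap.congr_fun hs x
    refine linearMap_ext_word fun w' => ?_
    rw [LinearMap.comp_apply, LinearMap.mulLeft_apply, LinearMap.zero_apply]
    rcases hr with (⟨w, hw', rfl⟩ | hr) | ⟨n, m, N, w, hnm, hN, rfl⟩
    · by_cases h0 : 0 < w'.sum
      · rw [hφ, map_mul, Module.End.mul_apply, H.word_eq_zero w' h0, map_zero, map_zero, map_zero]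
      · rw [← word_append]
        refine hdeg ?_ (hw _)
        rw [List.sum_append]
        omega
    · rw [Set.mem_singleton_iff] at hr
      rw [hr, sub_mul, map_sub, ← word_cons, ← Algebra.smul_def, map_smul]
      by_cases h0 : w'.sum = 0
      · have h1 := hw w'
        rw [h0, neg_zero] at h1
        have h2 := eq_C_of_mem_grade_zero h1
        rw [hφ, hφ, map_word_cons, h2, ← mul_one (MvPolynomial.C _), ← MvPolynomial.smul_eq_C_mul,
          bosonization_T, map_smul, ← bosonization_T (K := K), H.weight, smul_comm]
        simp
      · rw [hdeg (by simpa using h0) (hw w'), hdeg (by simpa using h0) (hw (0 :: w'))]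
        simp
    -- In total degree zero the right cut-off condition `w.sum + m - N ≤ 0` is the left one `0 ≤ n +
    -- N + w'.sum`, so the relator already kills `word w'` on the vacuum.
    · by_cases h0 : w.sum + n + m + w'.sum = 0
      · rw [hφ, map_mul, map_mul, Module.End.mul_apply, Module.End.mul_apply,
          H.relator_eq_zero n m N w' hnm (by omega), map_zero, map_zero, map_zero]
      · refine hdeg ?_ (d := 0 - w'.sum - (n + m) - w.sum) ?_
        · omega
        · rw [map_mul, map_mul, Module.End.mul_apply, Module.End.mul_apply]
          exact bosonization_word_mem t k w (bosonization_relator_mem t k n m N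
            (bosonization_word_mem t k w' one_mem_grade))

/-! ### The pairing -/

theorem exists_isPairing {t : K} (h : K) (ht0 : t ≠ 0) :
    ∃ B : Mdual t h →ₗ[K] M t h →ₗ[K] K, IsPairing t h B := by
  obtain ⟨φ, h1, hl, hr⟩ := exists_vacuumExpectation h ht0
  let P : Submodule (Free K) (Free K) := Submodule.span (Free K) (leftRelations t h)
  let P' : Submodule (Free K)ᵐᵒᵖ (Free K) := Submodule.span (Free K)ᵐᵒᵖ (rightRelations t h)
  have hP : ∀ y ∈ P, ∀ x, φ (x * y) = 0 := by
    intro y hy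
    induction hy using Submodule.span_induction with
    | mem y hy => exact hl y hy
    | zero => simp
    | add y z _ _ hy hz =>
      intro x
      rw [mul_add, map_add, hy, hz, add_zero]
    | smul a y _ hy =>
      intro x
      rw [smul_eq_mul, ← mul_assoc]
      exact hy _
  have hP' : ∀ x ∈ P', ∀ y, φ (x * y) = 0 := by
    intro x hx
    induction hx using Submodule.span_induction with
    | mem x hx => exact hr x hx
    | zero => simp
    | add y z _ _ hy hz =>
      intro x
      rw [add_mul, map_add, hy, hz, add_zero]
    | smul a x _ hx =>
      intro y
      rw [← MulOpposite.op_unop a, op_smul_eq_mul, mul_assoc]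
      exact hx _
  let F : Free K →ₗ[K] M t h →ₗ[K] K :=
    { toFun := fun x => (P.restrictScalars K).liftQ (φ ∘ₗ LinearMap.mulLeft K x)
        (fun y hy => hP y hy x) ∘ₗ (Submodule.Quotient.restrictScalarsEquiv K P).symm.toLinearMap
      map_add' := fun x y => by
        refine LinearMap.ext fun v => ?_
        obtain ⟨z, rfl⟩ := Submodule.Quotient.mk_surjective _ v
        change φ ((x + y) * z) = φ (x * z) + φ (y * z)
        rw [add_mul, map_add]
      map_smul' := fun a x => by
        refine LinearMap.ext fun v => ?_
        obtain ⟨z, rfl⟩ := Submodule.Quotient.mk_surjective _ v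
        change φ ((a • x) * z) = a • φ (x * z)
        rw [smul_mul_assoc, map_smul] }
  have hF : P'.restrictScalars K ≤ LinearMap.ker F := by
    intro x hx
    rw [LinearMap.mem_ker]
    refine LinearMap.ext fun v => ?_
    obtain ⟨z, rfl⟩ := Submodule.Quotient.mk_surjective _ v
    exact hP' x hx z
  refine ⟨(P'.restrictScalars K).liftQ F hF ∘ₗ
    (Submodule.Quotient.restrictScalarsEquiv K P').symm.toLinearMap, ?_, ?_⟩
  · change φ (1 * 1) = 1
    rw [mul_one, h1]
  · intro n u v
    obtain ⟨x, rfl⟩ := Submodule.Quotient.mk_surjective _ u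
    obtain ⟨z, rfl⟩ := Submodule.Quotient.mk_surjective _ v
    change φ (x * T n * z) = φ (x * (T n * z))
    rw [mul_assoc]

/-! ### The two highest weight modules -/

/-- The action of the free algebra on `M_h`. -/
def leftRep (t h : K) : Free K →ₐ[K] Module.End K (M t h) := Algebra.lsmul K K (M t h)

theorem leftRep_apply (t h : K) (x : Free K) (v : M t h) : leftRep t h x v = x • v := rfl

theorem leftRep_ket (t h : K) (x : Free K) :
    leftRep t h x (ket t h) = Submodule.Quotient.mk x := by
  rw [leftRep_apply, ket, ← Submodule.Quotient.mk_smul, smul_eq_mul, mul_one]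

theorem isHighestWeight_ket (t h : K) : IsHighestWeight t h (leftRep t h) (ket t h) where
  word_eq_zero w hw := by
    rw [leftRep_ket, Submodule.Quotient.mk_eq_zero]
    exact Submodule.subset_span (Or.inl (Or.inl ⟨w, hw, rfl⟩))
  weight := by
    have h1 : h • ket t h = leftRep t h (algebraMap K (Free K) h) (ket t h) := by
      rw [AlgHom.commutes, Module.algebraMap_end_apply]
    rw [h1, ← sub_eq_zero, ← LinearMap.sub_apply, ← map_sub, leftRep_ket,
      Submodule.Quotient.mk_eq_zero]
    exact Submodule.subset_span (Or.inl (Or.inr rfl))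
  relator_eq_zero n m N w hnm hN := by
    rw [← Module.End.mul_apply, ← map_mul, leftRep_ket, Submodule.Quotient.mk_eq_zero]
    exact Submodule.subset_span (Or.inr ⟨n, m, N, w, hnm, hN, rfl⟩)

/-- The antiautomorphism `T_n ↦ T_{-n}`. -/
def antiAut : Free K →ₐ[K] (Free K)ᵐᵒᵖ :=
  FreeAlgebra.lift K fun n => MulOpposite.op (T (-n))

theorem antiAut_T (n : ℤ) : antiAut (T n : Free K) = MulOpposite.op (T (-n)) := by
  simp [antiAut, T]

theorem sum_map_neg (w : List ℤ) : (w.map Neg.neg).sum = -w.sum := by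
  induction w with
  | nil => rfl
  | cons n w ih =>
    rw [List.map_cons, List.sum_cons, List.sum_cons, ih, neg_add]

theorem antiAut_word (w : List ℤ) :
    antiAut (word w : Free K) = MulOpposite.op (word (w.map Neg.neg).reverse) := by
  induction w with
  | nil => simp [word_nil]
  | cons n w ih =>
    rw [word_cons, map_mul, ih, antiAut_T, ← MulOpposite.op_mul, List.map_cons,
      List.reverse_cons, word_append]
    simp [word]

theorem antiAut_T_mul_T {a b a' b' : ℤ} (ha : a' = -b) (hb : b' = -a) :
    antiAut (T a * T b : Free K) = MulOpposite.op (T a' * T b') := by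
  rw [map_mul, antiAut_T, antiAut_T, ha, hb, MulOpposite.op_mul]

theorem antiAut_tail (t : K) {n m n' m' : ℤ} (hn : n' = -m) (hm : m' = -n) (N : ℕ) :
    antiAut (tail t n m N) = MulOpposite.op (tail t n' m' N) := by
  rw [tail, tail, map_sum, Finset.op_sum]
  refine Finset.sum_congr rfl fun l _ => ?_
  rw [map_smul, antiAut_T_mul_T (a' := m' - l) (b' := n' + l) (by omega) (by omega),
    MulOpposite.op_smul]

/-- Reversing products and negating indices replaces `(n, m)` by `(-m, -n)`. The two families of
relations involving `T_0` are exchanged, as are those for `m > 0` and `n < 0`; the mixed family is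
preserved. -/
theorem antiAut_bracket (t : K) {n m : ℤ} (hnm : m < n) (N : ℕ) :
    antiAut (bracket t n m N) = MulOpposite.op (bracket t (-m) (-n) N) := by
  unfold bracket
  by_cases h1 : 0 < m ∨ n < 0
  · have e : (-m - -n) = n - m := by ring
    rw [if_pos h1, if_pos (by omega), e, map_neg, map_smul, map_sum, MulOpposite.op_neg,
      MulOpposite.op_smul, Finset.op_sum]
    congr 2
    exact Finset.sum_congr rfl fun l _ => antiAut_T_mul_T (by omega) (by omega)
  rw [if_neg h1, if_neg (by omega : ¬(0 < -n ∨ -m < 0))]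
  by_cases h2 : m = 0
  · rw [if_pos h2, if_neg (by omega), if_pos (by omega), neg_neg, map_sub, map_neg, map_smul,
      map_smul, map_sum, MulOpposite.op_sub, MulOpposite.op_neg,
      MulOpposite.op_smul, MulOpposite.op_smul, Finset.op_sum,
      antiAut_tail t (n' := 0) (m' := -n) (by omega) (by omega)]
    congr 3
    exact Finset.sum_congr rfl fun l _ => antiAut_T_mul_T (by omega) (by omega)
  by_cases h3 : n = 0
  · rw [if_neg h2, if_pos h3, if_pos (by omega), map_sub, map_neg, map_smul,
      map_smul, map_sum, MulOpposite.op_sub, MulOpposite.op_neg,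
      MulOpposite.op_smul, MulOpposite.op_smul, Finset.op_sum,
      antiAut_tail t (n' := -m) (m' := 0) (by omega) (by omega)]
    congr 3
    exact Finset.sum_congr rfl fun l _ => antiAut_T_mul_T (by omega) (by omega)
  rw [if_neg h2, if_neg h3, if_neg (by omega : ¬-n = 0), if_neg (by omega : ¬-m = 0), map_add, map_sub, map_neg,
    map_smul, map_smul, MulOpposite.op_add, MulOpposite.op_sub, MulOpposite.op_neg,
    MulOpposite.op_smul, MulOpposite.op_smul, antiAut_tail t rfl rfl,
    antiAut_T_mul_T rfl rfl]
  congr 1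
  by_cases h4 : n + m = 0
  · rw [if_pos h4, if_pos (by omega), AlgHom.commutes]
    rfl
  · rw [if_neg h4, if_neg (by omega), map_zero, MulOpposite.op_zero]

theorem antiAut_relator (t : K) {n m : ℤ} (hnm : m < n) (N : ℕ) :
    antiAut (relator t n m N) = MulOpposite.op (relator t (-m) (-n) N) := by
  rw [relator, relator, map_sub, map_sub, antiAut_T_mul_T rfl rfl, antiAut_T_mul_T rfl rfl,
    antiAut_bracket t hnm, MulOpposite.op_sub, MulOpposite.op_sub]

/-- The action of the free algebra on `M_h^*`, twisted by the antiautomorphism. -/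
def rightRep (t h : K) : Free K →ₐ[K] Module.End K (Mdual t h) :=
  (Algebra.lsmul K K (Mdual t h)).comp antiAut

theorem rightRep_apply (t h : K) (x : Free K) (u : Mdual t h) :
    rightRep t h x u = antiAut x • u := rfl

theorem rightRep_T (t h : K) (n : ℤ) (u : Mdual t h) :
    rightRep t h (T n) u = MulOpposite.op (T (-n) : Free K) • u := by
  rw [rightRep_apply, antiAut_T]

theorem rightRep_bra (t h : K) (x : Free K) :
    rightRep t h x (bra t h) = Submodule.Quotient.mk (antiAut x).unop := by
  rw [rightRep_apply, bra, ← Submodule.Quotient.mk_smul, MulOpposite.smul_eq_mul_unop, one_mul]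

theorem isHighestWeight_bra (t h : K) : IsHighestWeight t h (rightRep t h) (bra t h) where
  word_eq_zero w hw := by
    rw [rightRep_bra, Submodule.Quotient.mk_eq_zero, antiAut_word, MulOpposite.unop_op]
    refine Submodule.subset_span (Or.inl (Or.inl ⟨_, ?_, rfl⟩))
    rw [List.sum_reverse, sum_map_neg]
    omega
  weight := by
    have h1 : h • bra t h = rightRep t h (algebraMap K (Free K) h) (bra t h) := by
      rw [AlgHom.commutes, Module.algebraMap_end_apply]
    rw [h1, ← sub_eq_zero, ← LinearMap.sub_apply, ← map_sub, rightRep_bra,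
      Submodule.Quotient.mk_eq_zero, map_sub, antiAut_T, AlgHom.commutes]
    exact Submodule.subset_span (Or.inl (Or.inr rfl))
  relator_eq_zero n m N w hnm hN := by
    rw [← Module.End.mul_apply, ← map_mul, rightRep_bra, Submodule.Quotient.mk_eq_zero, map_mul,
      antiAut_relator t hnm, antiAut_word, ← MulOpposite.op_mul, MulOpposite.unop_op]
    refine Submodule.subset_span (Or.inr ⟨-m, -n, N, _, by omega, ?_, rfl⟩)
    rw [List.sum_reverse, sum_map_neg]
    omega

theorem IsHighestWeight.apply_mem_of_mem {V : Type*} [AddCommGroup V] [Module K V] {t h : K}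
    {ρ : Free K →ₐ[K] Module.End K V} {v₀ : V} (H : IsHighestWeight t h ρ v₀) (w : List ℤ) :
    ρ (word w) v₀ ∈ ⨆ n, lowered ρ v₀ n := by
  induction w with
  | nil => exact mem_iSup_lowered.mpr ⟨0, by simpa [word_nil] using self_mem_lowered 0⟩
  | cons n w ih =>
    rw [map_word_cons]
    exact H.apply_mem_iSup_lowered n ih

theorem mem_iSup_lowered_ket {t h : K} (v : M t h) :
    v ∈ ⨆ n, lowered (leftRep t h) (ket t h) n := by
  obtain ⟨x, rfl⟩ := Submodule.Quotient.mk_surjective _ v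
  have hx : x ∈ Submodule.span K (Set.range (word : List ℤ → Free K)) := by
    rw [span_word]
    trivial
  induction hx using Submodule.span_induction with
  | mem x hx =>
    obtain ⟨w, rfl⟩ := hx
    rw [← leftRep_ket]
    exact (isHighestWeight_ket t h).apply_mem_of_mem w
  | zero => exact Submodule.zero_mem _
  | add x y _ _ hx hy => exact Submodule.add_mem _ hx hy
  | smul a x _ hx => exact Submodule.smul_mem _ a hx

theorem mem_iSup_lowered_bra {t h : K} (u : Mdual t h) :
    u ∈ ⨆ n, lowered (rightRep t h) (bra t h) n := by
  obtain ⟨x, rfl⟩ := Submodule.Quotient.mk_surjective _ u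
  have hx : x ∈ Submodule.span K (Set.range (word : List ℤ → Free K)) := by
    rw [span_word]
    trivial
  induction hx using Submodule.span_induction with
  | mem x hx =>
    obtain ⟨w, rfl⟩ := hx
    have := (isHighestWeight_bra t h).apply_mem_of_mem (w.reverse.map Neg.neg)
    rw [rightRep_bra, antiAut_word, MulOpposite.unop_op] at this
    simpa using this
  | zero => exact Submodule.zero_mem _
  | add x y _ _ hx hy => exact Submodule.add_mem _ hx hy
  | smul a x _ hx => exact Submodule.smul_mem _ a hx

/-! ### Whittaker vectors -/

section Whittaker

variable {V : Type*} [AddCommGroup V] [Module K V]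

/-- The squared norm `∏_{s=1}^r (1 - t^{-s})` of `T_{-1}^r |h⟩`. -/
def whittakerNorm (t : K) (r : ℕ) : K := ∏ s ∈ Finset.Icc 1 r, (1 - t⁻¹ ^ s)

theorem whittakerNorm_succ (t : K) (r : ℕ) :
    whittakerNorm t (r + 1) = whittakerNorm t r * (1 - t⁻¹ ^ (r + 1)) :=
  Finset.prod_Icc_succ_top (by omega) _

theorem one_sub_inv_pow_ne_zero {t : K} (ht : ∀ n : ℕ, 0 < n → t ^ n ≠ 1) (n : ℕ) :
    1 - t⁻¹ ^ (n + 1) ≠ 0 :=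
  sub_ne_zero.mpr fun h => ht (n + 1) (by omega) (by simpa using h.symm)

theorem whittakerNorm_ne_zero {t : K} (ht : ∀ n : ℕ, 0 < n → t ^ n ≠ 1) (r : ℕ) :
    whittakerNorm t r ≠ 0 := by
  induction r with
  | zero => simp [whittakerNorm]
  | succ r ih =>
    rw [whittakerNorm_succ]
    exact mul_ne_zero ih (one_sub_inv_pow_ne_zero ht r)

/-- The coefficients of the Whittaker vector `∑ Λ̃^{2r} T_{-1}^r |h⟩ / ∏_{s=1}^r (1 - t^{-s})`. -/
def whittaker (t : K) (ρ : Free K →ₐ[K] Module.End K V) (v₀ : V) (j : ℕ) : V :=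
  if Even j then (whittakerNorm t (j / 2))⁻¹ • (ρ (T (-1)) ^ (j / 2)) v₀ else 0

variable {ρ : Free K →ₐ[K] Module.End K V} {v₀ : V} {t h : K}

theorem pow_lower_mem_lowered (r : ℕ) : (ρ (T (-1)) ^ r) v₀ ∈ lowered ρ v₀ 1 := by
  induction r with
  | zero => exact self_mem_lowered 1
  | succ r ih =>
    rw [pow_succ', Module.End.mul_apply]
    exact apply_mem_lowered (by simp) (by simp) ih

namespace IsHighestWeight

/-- The oscillator relation for `n = 1` gives the recursion `e ↦ t⁻¹ e + (1 - t⁻¹)` for the factor,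
starting from `T_1 v₀ = 0`. -/
theorem raise_pow_lower (H : IsHighestWeight t h ρ v₀) (r : ℕ) :
    ρ (T 1) ((ρ (T (-1)) ^ (r + 1)) v₀) = (1 - t⁻¹ ^ (r + 1)) • (ρ (T (-1)) ^ r) v₀ := by
  have h0 := fun r => H.oscillator one_pos (pow_lower_mem_lowered (ρ := ρ) (v₀ := v₀) r)
  rw [Nat.cast_one] at h0
  induction r with
  | zero => simpa [H.pos_apply_self one_pos] using h0 0
  | succ r ih =>
    rw [pow_succ', Module.End.mul_apply, h0, ih, map_smul, ← Module.End.mul_apply (ρ (T (-1))),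
      ← pow_succ', pow_succ t⁻¹ (r + 1)]
    module

theorem raise_whittaker (H : IsHighestWeight t h ρ v₀) (ht : ∀ n : ℕ, 0 < n → t ^ n ≠ 1) (j : ℕ) :
    ρ (T 1) (whittaker t ρ v₀ j) = mulLambdaSq (whittaker t ρ v₀) j := by
  match j with
  | 0 => simp [whittaker, mulLambdaSq, H.pos_apply_self one_pos]
  | 1 => simp [whittaker, mulLambdaSq]
  | j + 2 =>
    have e : (j + 2) / 2 = j / 2 + 1 := by omega
    have e' : Even (j + 2) ↔ Even j := by simp [Nat.even_add]
    simp only [mulLambdaSq, whittaker, e, e']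
    split_ifs
    · rw [map_smul, H.raise_pow_lower, smul_smul, whittakerNorm_succ, mul_inv, mul_assoc,
        inv_mul_cancel₀ (one_sub_inv_pow_ne_zero ht _), mul_one]
    · rw [map_zero]

theorem apply_whittaker_eq_zero (H : IsHighestWeight t h ρ v₀) {n : ℤ} (hn : 1 < n) (j : ℕ) :
    ρ (T n) (whittaker t ρ v₀ j) = 0 := by
  unfold whittaker
  split_ifs
  · rw [map_smul, H.apply_eq_zero (n := 1) (by simpa using hn) (pow_lower_mem_lowered _),
      smul_zero]
  · rw [map_zero]

theorem functional_whittaker {f : V →ₗ[K] K} (hf0 : f v₀ = 1)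
    (hf : ∀ n : ℤ, n < 0 → ∀ v, f (ρ (T n) v) = 0) (j : ℕ) :
    f (whittaker t ρ v₀ j) = if j = 0 then 1 else 0 := by
  match j with
  | 0 => simp [whittaker, whittakerNorm, hf0]
  | 1 => simp [whittaker]
  | j + 2 =>
    have e : (j + 2) / 2 = j / 2 + 1 := by omega
    rw [if_neg (by omega)]
    simp only [whittaker, e, pow_succ', Module.End.mul_apply]
    split_ifs
    · rw [map_smul, hf (-1) (by omega), smul_zero]
    · rw [map_zero]

/-- Uniqueness of the Whittaker vector. -/
theorem eq_of_whittaker (H : IsHighestWeight t h ρ v₀) (ht0 : t ≠ 0)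
    (ht : ∀ n : ℕ, 0 < n → t ^ n ≠ 1) (hcyc : ∀ v, v ∈ ⨆ n, lowered ρ v₀ n) {f : V →ₗ[K] K}
    (hf0 : f v₀ = 1) {G G' : ℕ → V} (h1 : ∀ j, ρ (T 1) (G j) = mulLambdaSq G j)
    (h1' : ∀ j, ρ (T 1) (G' j) = mulLambdaSq G' j) (h2 : ∀ n : ℤ, 1 < n → ∀ j, ρ (T n) (G j) = 0)
    (h2' : ∀ n : ℤ, 1 < n → ∀ j, ρ (T n) (G' j) = 0)
    (h3 : ∀ j, f (G j) = f (G' j)) : G = G' := by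
  funext j
  induction j using Nat.strong_induction_on with
  | _ j ih =>
    have h4 : mulLambdaSq G j = mulLambdaSq G' j := by
      match j with
      | 0 => rfl
      | 1 => rfl
      | j + 2 => exact ih j (by omega)
    -- The lower coefficients agree, so the two Whittaker conditions have equal right-hand sides and
    -- the difference is killed by all `T_n`, `n > 0`. The normalization then fixes the remaining
    -- multiple of `v₀`.
    have h5 : G j - G' j ∈ Submodule.span K {v₀} := by
      refine H.mem_span_of_forall_apply_eq_zero ht0 ht (hcyc _) fun n hn => ?_
      rw [map_sub, sub_eq_zero]
      rcases eq_or_lt_of_le (show 1 ≤ n by omega) with rfl | hn'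
      · rw [h1, h1', h4]
      · rw [h2 n hn', h2' n hn']
    obtain ⟨a, ha⟩ := Submodule.mem_span_singleton.mp h5
    have h6 := congrArg f ha
    rw [map_smul, hf0, map_sub, h3, sub_self, smul_eq_mul, mul_one] at h6
    rw [h6, zero_smul] at ha
    exact (sub_eq_zero.mp ha.symm)

/-- Each `T_1` cancels one `T_{-1}`; a surplus of `T_1` meets `v₀`, a surplus of `T_{-1}` meets `f`,
and either gives zero. -/
theorem functional_pow_pow (H : IsHighestWeight t h ρ v₀) {f : V →ₗ[K] K} (hf0 : f v₀ = 1)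
    (hf : ∀ n : ℤ, n < 0 → ∀ v, f (ρ (T n) v) = 0) (r s : ℕ) :
    f ((ρ (T 1) ^ r) ((ρ (T (-1)) ^ s) v₀)) = if r = s then whittakerNorm t r else 0 := by
  induction r generalizing s with
  | zero =>
    cases s with
    | zero => simp [whittakerNorm, hf0]
    | succ s =>
      rw [pow_succ', Module.End.mul_apply, pow_zero, Module.End.one_apply, hf (-1) (by omega),
        if_neg (by omega)]
  | succ r ih =>
    rw [pow_succ, Module.End.mul_apply]
    cases s with
    | zero => simp [H.pos_apply_self one_pos]
    | succ s =>
      rw [H.raise_pow_lower, map_smul, map_smul, ih, whittakerNorm_succ]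
      by_cases h : r = s
      · subst h
        simp [mul_comm]
      · simp [h]

/-- A functional on a cyclic highest weight module is determined by its values at `v₀` and on the
images of the lowering operators. -/
theorem functional_ext (hcyc : ∀ v, v ∈ ⨆ n, lowered ρ v₀ n) {f g : V →ₗ[K] K}
    (h0 : f v₀ = g v₀) (hf : ∀ n : ℤ, n < 0 → ∀ v, f (ρ (T n) v) = 0)
    (hg : ∀ n : ℤ, n < 0 → ∀ v, g (ρ (T n) v) = 0) : f = g := by
  refine LinearMap.ext fun v => ?_
  obtain ⟨n, hn⟩ := mem_iSup_lowered.mp (hcyc v)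
  induction hn using Submodule.span_induction with
  | mem v hv =>
    obtain ⟨w, hw, rfl⟩ := hv
    cases w with
    | nil => simpa [word_nil] using h0
    | cons a w =>
      rw [map_word_cons, hf a (hw a (by simp)).2, hg a (hw a (by simp)).2]
  | zero => simp
  | add v v' _ _ hv hv' => rw [map_add, map_add, hv, hv']
  | smul a v _ hv => rw [map_smul, map_smul, hv]

end IsHighestWeight

end Whittaker

/-! ### The main theorem -/

section Pairing

variable {t h : K} {B : Mdual t h →ₗ[K] M t h →ₗ[K] K}

theorem op_T_smul_bra {n : ℤ} (hn : n < 0) :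
    MulOpposite.op (T n : Free K) • bra t h = 0 := by
  have := (isHighestWeight_bra t h).pos_apply_self (n := -n) (by omega)
  rwa [rightRep_T, neg_neg] at this

theorem IsPairing.bra_lower (hB : IsPairing t h B) {n : ℤ} (hn : n < 0) (v : M t h) :
    B (bra t h) (leftRep t h (T n) v) = 0 := by
  rw [leftRep_apply, ← hB.2, op_T_smul_bra hn, map_zero, LinearMap.zero_apply]

theorem IsPairing.lower_ket (hB : IsPairing t h B) {n : ℤ} (hn : n < 0) (u : Mdual t h) :
    B (rightRep t h (T n) u) (ket t h) = 0 := by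
  rw [rightRep_T, hB.2, ← leftRep_apply, (isHighestWeight_ket t h).pos_apply_self (by omega),
    map_zero]

/-- By normal ordering `M_h` is spanned by `|h⟩` and images of lowering operators, on which `⟨h|`
vanishes; this fixes the pairing with `⟨h|`. The remaining vectors of `M_h^*` are generated from
`⟨h|`, and invariance transfers the agreement. -/
theorem IsPairing.unique {B' : Mdual t h →ₗ[K] M t h →ₗ[K] K} (hB : IsPairing t h B)
    (hB' : IsPairing t h B') : B = B' := by
  have h0 : B (bra t h) = B' (bra t h) :=
    IsHighestWeight.functional_ext mem_iSup_lowered_ket (hB.1.trans hB'.1.symm)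
      (fun n hn v => hB.bra_lower hn v) fun n hn v => hB'.bra_lower hn v
  refine LinearMap.ext fun u => ?_
  obtain ⟨n, hn⟩ := mem_iSup_lowered.mp (mem_iSup_lowered_bra u)
  have h1 : lowered (rightRep t h) (bra t h) n ≤ LinearMap.eqLocus B B' := by
    refine lowered_le h0 fun a _ _ u hu => ?_
    rw [LinearMap.mem_eqLocus] at hu ⊢
    refine LinearMap.ext fun v => ?_
    rw [rightRep_T, hB.2, hB'.2, hu]
  exact h1 hn

theorem IsPairing.isWhittaker (hB : IsPairing t h B) (ht : ∀ n : ℕ, 0 < n → t ^ n ≠ 1) :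
    IsWhittaker t h B (whittaker t (leftRep t h) (ket t h)) :=
  ⟨(isHighestWeight_ket t h).raise_whittaker ht,
    fun _ hn => (isHighestWeight_ket t h).apply_whittaker_eq_zero hn,
    IsHighestWeight.functional_whittaker hB.1 fun _ hn v => hB.bra_lower hn v⟩

theorem IsPairing.eq_whittaker (hB : IsPairing t h B) (ht0 : t ≠ 0)
    (ht : ∀ n : ℕ, 0 < n → t ^ n ≠ 1) {G : ℕ → M t h} (hG : IsWhittaker t h B G) :
    G = whittaker t (leftRep t h) (ket t h) :=
  have hW := hB.isWhittaker ht
  (isHighestWeight_ket t h).eq_of_whittaker ht0 ht mem_iSup_lowered_ket (f := B (bra t h)) hB.1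
    hG.1 hW.1 hG.2.1 hW.2.1 fun j => (hG.2.2 j).trans (hW.2.2 j).symm

theorem IsPairing.isDualWhittaker (hB : IsPairing t h B) (ht : ∀ n : ℕ, 0 < n → t ^ n ≠ 1) :
    IsDualWhittaker t h B (whittaker t (rightRep t h) (bra t h)) := by
  refine ⟨fun j => ?_, fun n hn j => ?_, ?_⟩
  · rw [← rightRep_T]
    exact (isHighestWeight_bra t h).raise_whittaker ht j
  · have := (isHighestWeight_bra t h).apply_whittaker_eq_zero (n := -n) (by omega) j
    rwa [rightRep_T, neg_neg] at this
  · exact IsHighestWeight.functional_whittaker (f := B.flip (ket t h)) hB.1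
      fun _ hn u => hB.lower_ket hn u

theorem IsPairing.eq_dualWhittaker (hB : IsPairing t h B) (ht0 : t ≠ 0)
    (ht : ∀ n : ℕ, 0 < n → t ^ n ≠ 1) {G : ℕ → Mdual t h} (hG : IsDualWhittaker t h B G) :
    G = whittaker t (rightRep t h) (bra t h) := by
  have key : ∀ G : ℕ → Mdual t h, IsDualWhittaker t h B G →
      (∀ j, rightRep t h (T 1) (G j) = mulLambdaSq G j) ∧
        ∀ n : ℤ, 1 < n → ∀ j, rightRep t h (T n) (G j) = 0 := by
    intro G hG
    refine ⟨fun j => ?_, fun n hn j => ?_⟩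
    · rw [rightRep_T]
      exact hG.1 j
    · rw [rightRep_T]
      exact hG.2.1 _ (by omega) j
  have hW := hB.isDualWhittaker ht
  exact (isHighestWeight_bra t h).eq_of_whittaker ht0 ht mem_iSup_lowered_bra
    (f := B.flip (ket t h)) hB.1 (key _ hG).1 (key _ hW).1 (key _ hG).2 (key _ hW).2
    fun j => (hG.2.2 j).trans (hW.2.2 j).symm

theorem IsPairing.pow_raise (hB : IsPairing t h B) (r : ℕ) (u : Mdual t h) (v : M t h) :
    B ((rightRep t h (T (-1)) ^ r) u) v = B u ((leftRep t h (T 1) ^ r) v) := by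
  induction r generalizing u v with
  | zero => rfl
  | succ r ih =>
    rw [pow_succ', Module.End.mul_apply, rightRep_T, hB.2, neg_neg, ih, pow_succ,
      Module.End.mul_apply, leftRep_apply]

theorem IsPairing.whittaker_whittaker (hB : IsPairing t h B) (ht : ∀ n : ℕ, 0 < n → t ^ n ≠ 1)
    (i j : ℕ) :
    B (whittaker t (rightRep t h) (bra t h) i) (whittaker t (leftRep t h) (ket t h) j) =
      if Even i ∧ i = j then (whittakerNorm t (i / 2))⁻¹ else 0 := by
  by_cases hi : Even i
  swap
  · simp [whittaker, hi]
  by_cases hj : Even j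
  swap
  · rw [if_neg (by rintro ⟨h1, rfl⟩; exact hj h1)]
    simp [whittaker, hj]
  obtain ⟨a, rfl⟩ := hi
  obtain ⟨b, rfl⟩ := hj
  have ea : (a + a) / 2 = a := by omega
  have eb : (b + b) / 2 = b := by omega
  rw [whittaker, whittaker, if_pos ⟨a, rfl⟩, if_pos ⟨b, rfl⟩, ea, eb, map_smul, map_smul,
    LinearMap.smul_apply, hB.pow_raise, (isHighestWeight_ket t h).functional_pow_pow hB.1
      fun _ hn v => hB.bra_lower hn v]
  by_cases hab : a = b
  · subst hab
    rw [if_pos rfl, if_pos ⟨⟨a, rfl⟩, rfl⟩, smul_eq_mul, smul_eq_mul,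
      inv_mul_cancel₀ (whittakerNorm_ne_zero ht a), mul_one]
  · rw [if_neg hab, if_neg (by omega), smul_zero, smul_zero]

theorem IsPairing.innerProduct_whittaker (hB : IsPairing t h B)
    (ht : ∀ n : ℕ, 0 < n → t ^ n ≠ 1) :
    innerProduct B (whittaker t (rightRep t h) (bra t h)) (whittaker t (leftRep t h) (ket t h)) =
      PowerSeries.expand 4 four_ne_zero (PowerSeries.mk fun m => (whittakerNorm t m)⁻¹) := by
  ext N
  rw [innerProduct, PowerSeries.coeff_mk]
  simp only [hB.whittaker_whittaker ht]
  by_cases hN : 4 ∣ N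
  · obtain ⟨m, rfl⟩ := hN
    -- Only equal even indices pair nontrivially, so in degree `4m` the single contribution is that
    -- of `T_{-1}^m` on both sides, at index `2m` each.
    rw [PowerSeries.coeff_expand_mul, PowerSeries.coeff_mk,
      Finset.sum_eq_single (2 * m, 2 * m)]
    · have e : 2 * m / 2 = m := by omega
      simp [e]
    · rintro ⟨i, j⟩ hp hne
      rw [Finset.HasAntidiagonal.mem_antidiagonal] at hp
      simp only at hp ⊢
      rw [if_neg]
      rintro ⟨-, rfl⟩
      exact hne (by ext <;> simp <;> omega)
    · intro hp
      exact absurd (by rw [Finset.HasAntidiagonal.mem_antidiagonal]; simp only; omega) hp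
  · rw [PowerSeries.coeff_expand_of_not_dvd _ _ _ hN]
    refine Finset.sum_eq_zero fun p hp => ?_
    rw [Finset.HasAntidiagonal.mem_antidiagonal] at hp
    rw [if_neg]
    rintro ⟨⟨a, ha⟩, hp2⟩
    omega

end Pairing

end

end CrystalVirasoro

end

theorem mainTheorem2 {K : Type*} [Field K] [CharZero K] (t h Q : K)
    (ht0 : t ≠ 0) (ht : ∀ n : ℕ, 0 < n → t ^ n ≠ 1)
    (hQ0 : Q ≠ 0) (hQ : ∀ j : ℤ, Q ≠ t ^ j) :
    -- existence and uniqueness of the pairing and of the Whittaker vectors; the norm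
    (∃! B : CrystalVirasoro.Mdual t h →ₗ[K] CrystalVirasoro.M t h →ₗ[K] K,
      CrystalVirasoro.IsPairing t h B) ∧
    (∀ B : CrystalVirasoro.Mdual t h →ₗ[K] CrystalVirasoro.M t h →ₗ[K] K,
      CrystalVirasoro.IsPairing t h B →
        (∃! G : ℕ → CrystalVirasoro.M t h, CrystalVirasoro.IsWhittaker t h B G) ∧
        (∃! G' : ℕ → CrystalVirasoro.Mdual t h, CrystalVirasoro.IsDualWhittaker t h B G') ∧
        ∀ (G : ℕ → CrystalVirasoro.M t h) (G' : ℕ → CrystalVirasoro.Mdual t h),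
          CrystalVirasoro.IsWhittaker t h B G → CrystalVirasoro.IsDualWhittaker t h B G' →
            CrystalVirasoro.innerProduct B G' G =
              PowerSeries.expand 4 four_ne_zero (CrystalVirasoro.crystalPure t Q)) ∧
    -- the common value
    CrystalVirasoro.crystalPure t Q =
      PowerSeries.mk (fun m => (∏ s ∈ Finset.Icc 1 m, (1 - t ^ (-(s : ℤ))))⁻¹) ∧
    -- the limit `q → 0` of the Nekrasov function with `Λ⁴ = Λ̃⁴ t / q`, `Λ̃` fixed
    (∀ N : ℕ, CrystalVirasoro.TendsToAtZero
      (PowerSeries.coeff N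
        (PowerSeries.rescale ((RatFunc.C t : RatFunc K) / RatFunc.X)
          (CrystalVirasoro.nekrasovPure (RatFunc.X : RatFunc K) (RatFunc.C t) (RatFunc.C Q))))
      (PowerSeries.coeff N (CrystalVirasoro.crystalPure t Q))) := by
  refine ⟨?_, fun B hB => ⟨?_, ?_, ?_⟩, CrystalVirasoro.crystalPure_eq ht0 ht hQ0 hQ,
    CrystalVirasoro.tendsToAtZero_nekrasovPure ht0 ht hQ0 hQ⟩
  · obtain ⟨B, hB⟩ := CrystalVirasoro.exists_isPairing h ht0
    exact ⟨B, hB, fun B' hB' => hB'.unique hB⟩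
  · exact ⟨_, hB.isWhittaker ht, fun G hG => hB.eq_whittaker ht0 ht hG⟩
  · exact ⟨_, hB.isDualWhittaker ht, fun G hG => hB.eq_dualWhittaker ht0 ht hG⟩
  · intro G G' hG hG'
    rw [hB.eq_whittaker ht0 ht hG, hB.eq_dualWhittaker ht0 ht hG', hB.innerProduct_whittaker ht,
      CrystalVirasoro.crystalPure_eq ht0 ht hQ0 hQ]
    simp only [CrystalVirasoro.whittakerNorm, inv_pow, zpow_neg, zpow_natCast]
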